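/- Let $(A,\circ)$ be a nonzero finite-dimensional commutative, not necessarily associative or unital, algebra over $\mathbb{R}$, and write $L(x)y = x\circ y$. Suppose that $A$ is exact, meaning that $\operatorname{tr} L(x) = 0$ for all $x \in A$, and that $A$ is Euclidean Killing metrized, meaning that its Killing form $\tau(x,y) = \operatorname{tr} L(x)L(y)$ is positive definite (in particular nondegenerate) and invariant, i.e. $\tau(x\circ y, z) = \tau(x, y\circ z)$ for all $x,y,z \in A$. If $\dim A \leq 4$, then $A$ is isomorphic, as an $\mathbb{R}$-algebra, to exactly one of $E^2(\mathbb{R})$, $E^3(\mathbb{R})$, $E^4(\mathbb{R})$ or $E^2(\mathbb{R})\oplus E^2(\mathbb{R})$. Here, for $n \geq 2$, the simplicial algebra $E^n(\mathbb{R})$ is the quotient by its maximal ideal (which is the line spanned by $\sum_{i=0}^{n} e_i$) of the commutative algebra with basis $e_0, \dots, e_n$ and multiplication $e_i\circ e_i = e_i$ and $e_i\circ e_j = -\tfrac{1}{n-1}(e_i+e_j)$ for $i \neq j$; the direct sum carries the componentwise multiplication. -/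

import Mathlib

/-! ### Killing forms of commutative algebras

A commutative, not necessarily associative or unital, algebra over a field `F` is a type `A` with
`[NonUnitalNonAssocCommRing A] [Module F A] [IsScalarTower F A A] [SMulCommClass F A A]`,
so that the multiplication is `F`-bilinear. -/

section Killing

variable (F A : Type*) [Field F] [NonUnitalNonAssocRing A] [Module F A]
  [IsScalarTower F A A] [SMulCommClass F A A]

/-- The Killing form `τ(x, y) = tr (L(x) L(y))`, with `L(x) y = x * y`. -/
noncomputable def algKillingForm : LinearMap.BilinForm F A :=
  ((LinearMap.mul F (Module.End F A)).compl₁₂ (LinearMap.mul F A) (LinearMap.mul F A)).compr₂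
    (LinearMap.trace F A)

theorem algKillingForm_apply (x y : A) :
    algKillingForm F A x y
      = LinearMap.trace F A (LinearMap.mulLeft F x ∘ₗ LinearMap.mulLeft F y) := rfl

/-- The algebra is exact: every multiplication endomorphism is trace-free. -/
def IsExactAlg : Prop := ∀ x : A, LinearMap.trace F A (LinearMap.mulLeft F x) = 0

/-- The algebra is Killing metrized: its Killing form is invariant and nondegenerate. -/
structure IsKillingMetrized : Prop where
  invariant : ∀ x y z : A, algKillingForm F A (x * y) z = algKillingForm F A x (y * z)
  nondegenerate : (algKillingForm F A).Nondegenerate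

end Killing

/-- The real algebra is Euclidean Killing metrized: it is Killing metrized and the metric given by
the Killing form is positive definite. -/
structure IsEuclideanKillingMetrized (A : Type*) [NonUnitalNonAssocRing A] [Module ℝ A]
    [IsScalarTower ℝ A A] [SMulCommClass ℝ A A] : Prop extends IsKillingMetrized ℝ A where
  posDef : ∀ x : A, x ≠ 0 → 0 < algKillingForm ℝ A x x

/-- Isomorphism of (not necessarily associative or unital) `F`-algebras. -/
def AlgIsomorphic (F A B : Type*) [Field F] [NonUnitalNonAssocRing A] [Module F A]
    [NonUnitalNonAssocRing B] [Module F B] : Prop :=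
  ∃ e : A ≃ₗ[F] B, ∀ x y : A, e (x * y) = e x * e y

/-! ### Ideals and quotients -/

section Ideals

variable (F : Type*) {A : Type*} [Field F] [NonUnitalNonAssocCommRing A] [Module F A]

/-- The subspace `I` is an ideal of the commutative algebra `A`. -/
def IsAlgIdeal (I : Submodule F A) : Prop := ∀ a : A, ∀ x ∈ I, a * x ∈ I

variable (A) in
/-- The sum of all proper ideals. When `A` has a largest proper ideal this is that ideal. -/
def maxAlgIdeal : Submodule F A := sSup {I : Submodule F A | IsAlgIdeal F I ∧ I ≠ ⊤}

theorem isAlgIdeal_maxAlgIdeal [SMulCommClass F A A] : IsAlgIdeal F (maxAlgIdeal F A) := by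
  intro a
  have h : maxAlgIdeal F A ≤ (maxAlgIdeal F A).comap (LinearMap.mulLeft F a) := by
    conv_lhs => unfold maxAlgIdeal
    refine sSup_le fun I hI x hx => ?_
    exact (le_sSup hI : I ≤ maxAlgIdeal F A) (hI.1 a x hx)
  exact fun x hx => h hx

/-- The quotient algebra of a commutative algebra by an ideal. -/
abbrev algQuotientRing {I : Submodule F A} (hI : IsAlgIdeal F I) :
    NonUnitalNonAssocCommRing (A ⧸ I) :=
  { (inferInstance : AddCommGroup (A ⧸ I)) with
    mul := Quotient.map₂ (· * ·) (by
      intro a b hab c d hcd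
      replace hab := (Submodule.quotientRel_def I).1 hab
      replace hcd := (Submodule.quotientRel_def I).1 hcd
      refine (Submodule.quotientRel_def I).2 ?_
      have h : a * c - b * d = c * (a - b) + b * (c - d) := by
        rw [mul_sub, mul_sub, mul_comm c a, mul_comm c b]; abel
      rw [h]
      exact I.add_mem (hI _ _ hab) (hI _ _ hcd))
    left_distrib := by
      rintro ⟨a⟩ ⟨b⟩ ⟨c⟩
      exact congrArg (Submodule.Quotient.mk (p := I)) (mul_add a b c)
    right_distrib := by
      rintro ⟨a⟩ ⟨b⟩ ⟨c⟩
      exact congrArg (Submodule.Quotient.mk (p := I)) (add_mul a b c)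
    zero_mul := by
      rintro ⟨a⟩
      exact congrArg (Submodule.Quotient.mk (p := I)) (zero_mul a)
    mul_zero := by
      rintro ⟨a⟩
      exact congrArg (Submodule.Quotient.mk (p := I)) (mul_zero a)
    mul_comm := by
      rintro ⟨a⟩ ⟨b⟩
      exact congrArg (Submodule.Quotient.mk (p := I)) (mul_comm a b) }

end Ideals

/-! ### The algebras `T^n_α(F)` -/

section TAlg

variable (F : Type*) [Field F] (n : ℕ) (α : F)

/-- The algebra `T^n_α(F)`: the vector space with basis `e_i`, `i : Fin n`, and the commutative
multiplication with `e_i * e_i = e_i` and `e_i * e_j = α (e_i + e_j)` for `i ≠ j`. -/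
@[nolint unusedArguments]
def TAlg (_α : F) : Type _ := Fin n → F

namespace TAlg

instance : AddCommGroup (TAlg F n α) := inferInstanceAs (AddCommGroup (Fin n → F))

instance : Module F (TAlg F n α) := inferInstanceAs (Module F (Fin n → F))

variable {F n α}

/-- The coefficients of an element with respect to the basis `e_i`. -/
def coeff : TAlg F n α ≃ₗ[F] (Fin n → F) := LinearEquiv.refl F (Fin n → F)

/-- The basis vector `e_i`. -/
def e (i : Fin n) : TAlg F n α := coeff.symm (Pi.single i 1)

/-- The coefficient of `e_k` in `(∑ i, x_i e_i) * (∑ j, y_j e_j)`. -/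
instance : Mul (TAlg F n α) where
  mul x y := coeff.symm fun k =>
    coeff x k * coeff y k
      + α * ∑ j ∈ Finset.univ.erase k, (coeff x k * coeff y j + coeff x j * coeff y k)

theorem ext_coeff {x y : TAlg F n α} (h : ∀ k, coeff x k = coeff y k) : x = y :=
  coeff.injective (funext h)

theorem coeff_e (i k : Fin n) : coeff (e i : TAlg F n α) k = if k = i then 1 else 0 := by
  simp [e, Pi.single_apply]

theorem coeff_mul (x y : TAlg F n α) (k : Fin n) :
    coeff (x * y) k = coeff x k * coeff y k
      + α * ∑ j ∈ Finset.univ.erase k, (coeff x k * coeff y j + coeff x j * coeff y k) := rfl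

instance : NonUnitalNonAssocCommRing (TAlg F n α) :=
  { (inferInstance : AddCommGroup (TAlg F n α)), (inferInstance : Mul (TAlg F n α)) with
    left_distrib := by
      intro x y z
      refine ext_coeff fun k => ?_
      simp only [coeff_mul, map_add, Pi.add_apply, mul_add, Finset.sum_add_distrib]
      ring
    right_distrib := by
      intro x y z
      refine ext_coeff fun k => ?_
      simp only [coeff_mul, map_add, Pi.add_apply, mul_add, add_mul, Finset.sum_add_distrib]
      ring
    zero_mul := by
      intro x
      refine ext_coeff fun k => ?_
      simp [coeff_mul]
    mul_zero := by
      intro x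
      refine ext_coeff fun k => ?_
      simp [coeff_mul]
    mul_comm := by
      intro x y
      refine ext_coeff fun k => ?_
      simp only [coeff_mul]
      rw [mul_comm (coeff x k) (coeff y k)]
      congr 2
      exact Finset.sum_congr rfl fun j _ => by ring }

instance : IsScalarTower F (TAlg F n α) (TAlg F n α) where
  smul_assoc c x y := by
    refine ext_coeff fun k => ?_
    simp only [smul_eq_mul, coeff_mul, map_smul, Pi.smul_apply, mul_add, Finset.mul_sum]
    congr 1
    · ring
    · exact Finset.sum_congr rfl fun j _ => by ring

instance : SMulCommClass F (TAlg F n α) (TAlg F n α) where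
  smul_comm c x y := by
    simp only [smul_eq_mul]
    rw [mul_comm x (c • y), mul_comm x y, smul_mul_assoc]

theorem eq_sum_e (x : TAlg F n α) : x = ∑ i, coeff x i • e i := by
  refine ext_coeff fun k => ?_
  simp [map_sum, coeff_e]

theorem mul_e (x : TAlg F n α) (i : Fin n) :
    x * e i = α • x + ((1 - 2 * α) * coeff x i + α * ∑ j, coeff x j) • e i := by
  refine ext_coeff fun k => ?_
  have h := Finset.add_sum_erase Finset.univ (coeff x) (Finset.mem_univ i)
  rw [coeff_mul, Finset.sum_add_distrib, ← Finset.mul_sum, ← Finset.sum_mul, ← h]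
  have hs : ∑ m ∈ Finset.univ.erase k, coeff (e i : TAlg F n α) m = if i = k then 0 else 1 := by
    simp [coeff_e]
  rw [hs]
  simp only [map_add, map_smul, Pi.add_apply, Pi.smul_apply, smul_eq_mul, coeff_e]
  by_cases h1 : k = i
  · subst h1
    simp
    ring
  · simp [h1, Ne.symm h1]

theorem e_mul_e_self (i : Fin n) : (e i : TAlg F n α) * e i = e i := by
  rw [mul_e]
  simp only [coeff_e, Finset.sum_ite_eq', Finset.mem_univ, if_true, ← add_smul]
  convert one_smul F _ using 2
  ring

theorem e_mul_e_of_ne {i j : Fin n} (hij : i ≠ j) :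
    (e i : TAlg F n α) * e j = α • (e i + e j) := by
  rw [mul_e]
  simp [coeff_e, hij.symm]

end TAlg

end TAlg

/-! ### The simplicial algebras `E^n(F)` -/

section EAlg

variable (F : Type*) [Field F] (n : ℕ)

/-- The simplicial algebra `E^n(F)`, for `n ≥ 2` and `F` of characteristic zero: the quotient of
`T^{n+1}_α(F)`, `α = -1/(n-1)`, by its maximal ideal. -/
def EAlg : Type _ :=
  TAlg F (n + 1) (-1 / ((n : F) - 1)) ⧸ maxAlgIdeal F (TAlg F (n + 1) (-1 / ((n : F) - 1)))

noncomputable instance : NonUnitalNonAssocCommRing (EAlg F n) :=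
  algQuotientRing F
    (isAlgIdeal_maxAlgIdeal (A := TAlg F (n + 1) (-1 / ((n : F) - 1))) F)

noncomputable instance : Module F (EAlg F n) :=
  inferInstanceAs (Module F (TAlg F (n + 1) (-1 / ((n : F) - 1)) ⧸
    maxAlgIdeal F (TAlg F (n + 1) (-1 / ((n : F) - 1)))))

instance : IsScalarTower F (EAlg F n) (EAlg F n) where
  smul_assoc := by
    rintro c ⟨x⟩ ⟨y⟩
    exact congrArg (Submodule.Quotient.mk (p := maxAlgIdeal F _)) (smul_mul_assoc c x y)

instance : SMulCommClass F (EAlg F n) (EAlg F n) where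
  smul_comm c x y := by
    simp only [smul_eq_mul]
    rw [mul_comm x (c • y), mul_comm x y, smul_mul_assoc]

/-- The quotient map `T^{n+1}_α(F) → E^n(F)`. -/
noncomputable def EAlg.mk : TAlg F (n + 1) (-1 / ((n : F) - 1)) →ₗ[F] EAlg F n :=
  Submodule.mkQ (maxAlgIdeal F (TAlg F (n + 1) (-1 / ((n : F) - 1))))

theorem EAlg.mk_mul (x y : TAlg F (n + 1) (-1 / ((n : F) - 1))) :
    EAlg.mk F n (x * y) = EAlg.mk F n x * EAlg.mk F n y := rfl

/-- For `n ≥ 2` the line spanned by `∑ i, e_i` is the largest proper ideal of `T^{n+1}_α(F)`,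
`α = -1/(n-1)`. -/
theorem isGreatest_span_sum_e [CharZero F] {n : ℕ} (hn : 2 ≤ n) :
    IsGreatest {I : Submodule F (TAlg F (n + 1) (-1 / ((n : F) - 1))) | IsAlgIdeal F I ∧ I ≠ ⊤}
      (Submodule.span F {∑ i, TAlg.e i}) := by
  have hn1 : (n : F) - 1 ≠ 0 := by
    rw [sub_ne_zero]; exact_mod_cast (by omega : n ≠ 1)
  have hnp : (n : F) + 1 ≠ 0 := by exact_mod_cast (by omega : n + 1 ≠ 0)
  set α : F := -1 / ((n : F) - 1) with hα
  have hα0 : α ≠ 0 := by simp [hα, hn1]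
  have hα1 : 1 + ((n : F) - 1) * α = 0 := by rw [hα]; field_simp; ring
  have hα2 : 1 - 2 * α ≠ 0 := by
    have : 1 - 2 * α = ((n : F) + 1) / ((n : F) - 1) := by rw [hα]; field_simp; ring
    rw [this]; exact div_ne_zero hnp hn1
  have hs (k : Fin (n + 1)) : TAlg.coeff (∑ i, TAlg.e i : TAlg F (n + 1) α) k = 1 := by
    simp [map_sum, TAlg.coeff_e]
  refine ⟨⟨?_, ?_⟩, ?_⟩
  · intro a x hx
    obtain ⟨c, rfl⟩ := Submodule.mem_span_singleton.1 hx
    have key (i : Fin (n + 1)) : (∑ j, TAlg.e j : TAlg F (n + 1) α) * TAlg.e i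
        = α • ∑ j, TAlg.e j := by
      rw [TAlg.mul_e]
      simp only [hs]
      have : (1 - 2 * α) * 1 + α * ∑ _j : Fin (n + 1), (1 : F) = 0 := by
        simp; linear_combination hα1
      rw [this, zero_smul, add_zero]
    rw [mul_smul_comm, mul_comm, TAlg.eq_sum_e a, Finset.mul_sum]
    refine Submodule.smul_mem _ _ (Submodule.sum_mem _ fun i _ => ?_)
    rw [mul_smul_comm, key]
    exact Submodule.smul_mem _ _ (Submodule.smul_mem _ _ (Submodule.mem_span_singleton_self _))
  · intro h
    have : (TAlg.e 0 : TAlg F (n + 1) α) ∈ Submodule.span F {∑ i, TAlg.e i} := by rw [h]; trivial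
    obtain ⟨c, hc⟩ := Submodule.mem_span_singleton.1 this
    have h0 := congrFun (congrArg TAlg.coeff hc) 0
    have h1 := congrFun (congrArg TAlg.coeff hc) (Fin.last n)
    rw [map_smul, Pi.smul_apply, hs, TAlg.coeff_e] at h0 h1
    have hl : Fin.last n ≠ 0 := by simp [Fin.ext_iff]; omega
    simp [hl] at h0 h1
    exact one_ne_zero (h0.symm.trans h1)
  · rintro I ⟨hI, hIt⟩ a ha
    by_cases H : ∀ i, (1 - 2 * α) * TAlg.coeff a i + α * ∑ j, TAlg.coeff a j = 0
    · refine Submodule.mem_span_singleton.2 ⟨TAlg.coeff a 0, ?_⟩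
      refine TAlg.ext_coeff fun k => ?_
      rw [map_smul, Pi.smul_apply, hs, smul_eq_mul, mul_one]
      have : (1 - 2 * α) * TAlg.coeff a 0 = (1 - 2 * α) * TAlg.coeff a k := by linear_combination H 0 - H k
      exact mul_left_cancel₀ hα2 this
    · exfalso
      push Not at H
      obtain ⟨i, hi⟩ := H
      have hei : TAlg.e i ∈ I := by
        have h1 := I.sub_mem (hI (TAlg.e i) a ha) (I.smul_mem α ha)
        rw [mul_comm, TAlg.mul_e, add_sub_cancel_left] at h1
        exact (I.smul_mem_iff hi).1 h1
      apply hIt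
      rw [Submodule.eq_top_iff']
      intro x
      rw [TAlg.eq_sum_e x]
      refine I.sum_mem fun j _ => I.smul_mem _ ?_
      by_cases hij : j = i
      · rwa [hij]
      · have h1 := hI (TAlg.e j) _ hei
        rw [TAlg.e_mul_e_of_ne hij] at h1
        have h2 := (I.smul_mem_iff hα0).1 h1
        simpa using I.sub_mem h2 hei

theorem maxAlgIdeal_TAlg [CharZero F] {n : ℕ} (hn : 2 ≤ n) :
    maxAlgIdeal F (TAlg F (n + 1) (-1 / ((n : F) - 1)))
      = Submodule.span F {∑ i, TAlg.e i} :=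
  (isGreatest_span_sum_e F hn).isLUB.sSup_eq

end EAlg

/-! The Killing form turns `A` into a Euclidean space on which every `L(x)` is symmetric and
trace-free. The cubic form `⟪x ∘ x, x⟫` is then nonzero, and at a maximum `e` on the unit sphere the
first-order condition reads `e ∘ e = c e` with `c > 0`, while the second-order condition bounds the
eigenvalues of `L(e)` on the complement of `e` by `c / 2` (`exists_extremal`).

Diagonalize `L(e)` on that complement, with eigenvalues `a i`, and let `C` be the totally symmetric
structure constants of the product compressed to it. Exactness and the Killing identity become
polynomial equations in `a` and `C` (`IsComplementData`). When the complement has dimension at most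
three, they and the bound `c / 2` leave two cases (`eig_eq_of_two`, `eig_eq_or_exists`).

If `L(e)` is scalar on the complement, the compressed product is again trace-free and metrized, with
Killing form a positive multiple of the metric once the complement has dimension at least two. By
induction it contains a simplex of idempotents, to which `e / c` is added as a new vertex
(`hasSimplex_succ`). Otherwise the dimension is four and some eigenvector `f` spans with `e` a
two-dimensional ideal, whose orthogonal complement is a second one (`hasSplitting_of_eig`).

A simplex of idempotents is the image of the basis of `T^{n+1}_α` under a homomorphism whose kernel
is exactly the maximal ideal, so it yields a copy of `E^n` (`exists_embedding`). For uniqueness,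
dimension separates all candidates except `E^4` and `E^2 ⊕ E^2`, and `E^n` is never a direct sum of
two nonzero algebras. -/

open scoped InnerProductSpace

/-! ### Maxima of the cubic form on the unit sphere. -/

section Extremum

/-- If `3 t μ + 3 t² a + t³ p` is bounded by `c (3 t² / 2 + t⁴ / 2)` for all `t`, then the linear
term vanishes and the quadratic one is at most `c / 2`. -/
theorem linear_eq_zero_and_quadratic_le {μ a p c : ℝ}
    (h : ∀ t : ℝ, 3 * t * μ + 3 * t ^ 2 * a + t ^ 3 * p ≤ c * (3 / 2 * t ^ 2 + t ^ 4 / 2)) :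
    μ = 0 ∧ a ≤ c / 2 := by
  -- The difference of the two sides is nonnegative and vanishes at `t = 0`, so its derivative `-3
  -- μ` there is zero.
  have hμ : μ = 0 := by
    let φ : ℝ → ℝ := fun t =>
      c * (3 / 2 * t ^ 2 + t ^ 4 / 2) - (3 * t * μ + 3 * t ^ 2 * a + t ^ 3 * p)
    have hmin : IsLocalMin φ 0 := by
      refine Filter.Eventually.of_forall fun t => ?_
      have := h t
      simp only [φ]
      norm_num
      linarith
    have hd : HasDerivAt φ (-(3 * μ)) 0 := by
      have h1 := hasDerivAt_id (0 : ℝ)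
      have h2 := hasDerivAt_pow 2 (0 : ℝ)
      have h3 := hasDerivAt_pow 3 (0 : ℝ)
      have h4 := hasDerivAt_pow 4 (0 : ℝ)
      have := ((((h2.const_mul (3 / 2)).add (h4.div_const 2)).const_mul c).sub
        ((((h1.const_mul 3).mul_const μ).add ((h2.const_mul 3).mul_const a)).add
          (h3.mul_const p)))
      refine this.congr_deriv ?_
      norm_num
    have := hmin.hasDerivAt_eq_zero hd
    linarith
  refine ⟨hμ, ?_⟩
  subst hμ
  refine le_of_forall_pos_le_add fun ε hε => ?_
  obtain ⟨t, ht0, ht⟩ : ∃ t : ℝ, 0 < t ∧ c * t ^ 2 ≤ 6 * ε := by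
    refine ⟨√(ε / (|c| + 1)), by positivity, ?_⟩
    rw [Real.sq_sqrt (by positivity), mul_div_assoc', div_le_iff₀ (by positivity)]
    nlinarith [abs_nonneg c, le_abs_self c]
  -- Adding the inequalities at `t` and `-t` cancels the cubic term and leaves `a ≤ c / 2 + c t² /
  -- 6`.
  have h1 := h t
  have h2 := h (-t)
  have h3 : t ^ 2 * a ≤ t ^ 2 * (c / 2 + ε) := by nlinarith [sq_nonneg t]
  exact le_of_mul_le_mul_left h3 (by positivity)

theorem Real.sqrt_one_add_le_one_add_half {x : ℝ} (hx : 0 ≤ x) : √(1 + x) ≤ 1 + x / 2 := by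
  rw [Real.sqrt_le_left (by positivity)]
  nlinarith

variable {V : Type*} [NormedAddCommGroup V] [InnerProductSpace ℝ V]

/-- A commutative multiplication for which the inner product is invariant. -/
structure IsMetrized (m : V →ₗ[ℝ] V →ₗ[ℝ] V) : Prop where
  comm : ∀ x y, m x y = m y x
  invariant : ∀ x y z, ⟪m x y, z⟫_ℝ = ⟪x, m y z⟫_ℝ

namespace IsMetrized

variable {m : V →ₗ[ℝ] V →ₗ[ℝ] V}

theorem inner_left (hm : IsMetrized m) (x y z : V) : ⟪m x y, z⟫_ℝ = ⟪y, m x z⟫_ℝ := by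
  rw [hm.comm, hm.invariant]

theorem isSymmetric (hm : IsMetrized m) (x : V) : (m x).IsSymmetric := fun y z =>
  hm.inner_left x y z

theorem inner_swap (hm : IsMetrized m) (x y z : V) : ⟪m x y, z⟫_ℝ = ⟪m x z, y⟫_ℝ := by
  rw [hm.inner_left, real_inner_comm]

theorem inner_rotate (hm : IsMetrized m) (x y z : V) : ⟪m x y, z⟫_ℝ = ⟪m y z, x⟫_ℝ := by
  rw [hm.invariant, real_inner_comm]

theorem cubic_add_smul (hm : IsMetrized m) (x y : V) (t : ℝ) :
    ⟪m (x + t • y) (x + t • y), x + t • y⟫_ℝ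
      = ⟪m x x, x⟫_ℝ + 3 * t * ⟪m x x, y⟫_ℝ + 3 * t ^ 2 * ⟪m x y, y⟫_ℝ
        + t ^ 3 * ⟪m y y, y⟫_ℝ := by
  simp only [map_add, map_smul, LinearMap.add_apply, LinearMap.smul_apply, inner_add_left,
    inner_add_right, real_inner_smul_left, real_inner_smul_right]
  rw [hm.comm y x, hm.inner_swap x y x, hm.inner_rotate y y x, hm.comm y x]
  ring

/-- Polarization: adding the expansions at `x + y` and `x - y` isolates `⟪m x y, y⟫`, the quadratic
form of the symmetric operator `m x`. -/
theorem eq_zero_of_cubic_eq_zero (hm : IsMetrized m) (h : ∀ x, ⟪m x x, x⟫_ℝ = 0) : m = 0 := by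
  refine LinearMap.ext fun x => ((hm.isSymmetric x).inner_map_self_eq_zero).1 fun y => ?_
  have h1 := hm.cubic_add_smul x y 1
  have h2 := hm.cubic_add_smul x y (-1)
  simp only [h] at h1 h2
  linarith

/-- Take `e` maximizing the cubic form on the unit sphere and compare its values along `e + t f`
with `c ‖e + t f‖³`. The term linear in `t` gives the eigenvector equation, the quadratic one the
bound `c / 2`. -/
theorem exists_extremal [FiniteDimensional ℝ V] (hm : IsMetrized m) (h0 : m ≠ 0) :
    ∃ (e : V) (c : ℝ), ‖e‖ = 1 ∧ 0 < c ∧ m e e = c • e ∧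
      ∀ f, ⟪e, f⟫_ℝ = 0 → ‖f‖ = 1 → ⟪m e f, f⟫_ℝ ≤ c / 2 := by
  have hcont : Continuous fun x => ⟪m x x, x⟫_ℝ := by
    have h1 : Continuous (LinearMap.toContinuousLinearMap.toLinearMap ∘ₗ m : V →ₗ[ℝ] V →L[ℝ] V) :=
      LinearMap.continuous_of_finiteDimensional _
    exact (h1.clm_apply continuous_id).inner continuous_id
  obtain ⟨x₀, hx₀⟩ : ∃ x, ⟪m x x, x⟫_ℝ ≠ 0 := by
    by_contra! h
    exact h0 (hm.eq_zero_of_cubic_eq_zero h)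
  have hscale (r : ℝ) (x : V) :
      ⟪m (r • x) (r • x), r • x⟫_ℝ = r ^ 3 * ⟪m x x, x⟫_ℝ := by
    simp only [map_smul, LinearMap.smul_apply, real_inner_smul_left, real_inner_smul_right]
    ring
  have hx₀0 : x₀ ≠ 0 := by
    rintro rfl
    simp at hx₀
  have : Nontrivial V := ⟨x₀, 0, hx₀0⟩
  obtain ⟨e, he, hmax⟩ := (isCompact_sphere (0 : V) 1).exists_isMaxOn
    (NormedSpace.sphere_nonempty.2 zero_le_one) hcont.continuousOn
  have he1 : ‖e‖ = 1 := by simpa using he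
  set c := ⟪m e e, e⟫_ℝ with hc
  have hbound (x : V) : ⟪m x x, x⟫_ℝ ≤ c * ‖x‖ ^ 3 := by
    by_cases hx : x = 0
    · simp [hx]
    have hn : 0 < ‖x‖ := norm_pos_iff.2 hx
    have h1 : ⟪m (‖x‖⁻¹ • x) (‖x‖⁻¹ • x), ‖x‖⁻¹ • x⟫_ℝ ≤ c :=
      hmax (by simp [norm_smul, hn.ne'])
    rw [hscale, inv_pow, inv_mul_le_iff₀ (by positivity)] at h1
    linarith
  -- The cubic form is odd, so it is positive at one of `x₀`, `-x₀`.
  have hc0 : 0 < c := by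
    have h1 := hbound x₀
    have h2 := hbound (-x₀)
    have h3 := hscale (-1) x₀
    rw [neg_one_smul] at h3
    rw [norm_neg, h3] at h2
    have hn : 0 < ‖x₀‖ ^ 3 := pow_pos (norm_pos_iff.2 hx₀0) 3
    rcases hx₀.lt_or_gt with h | h
    · exact pos_of_mul_pos_left (by linarith) hn.le
    · exact pos_of_mul_pos_left (by linarith) hn.le
  have key (f : V) (hef : ⟪e, f⟫_ℝ = 0) (hf : ‖f‖ = 1) :
      ⟪m e e, f⟫_ℝ = 0 ∧ ⟪m e f, f⟫_ℝ ≤ c / 2 := by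
    refine linear_eq_zero_and_quadratic_le (p := ⟪m f f, f⟫_ℝ) fun t => ?_
    have h1 := hbound (e + t • f)
    have hsq : ‖e + t • f‖ ^ 2 = 1 + t ^ 2 := by
      rw [norm_add_sq_real, real_inner_smul_right, hef, norm_smul, he1, hf]
      simp
    have hn : ‖e + t • f‖ ≤ 1 + t ^ 2 / 2 := by
      rw [← Real.sqrt_sq (norm_nonneg (e + t • f)), hsq]
      exact Real.sqrt_one_add_le_one_add_half (sq_nonneg t)
    have h3 : ‖e + t • f‖ ^ 3 ≤ (1 + t ^ 2) * (1 + t ^ 2 / 2) := by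
      rw [pow_succ, hsq]
      gcongr
    rw [hm.cubic_add_smul, ← hc] at h1
    nlinarith [mul_le_mul_of_nonneg_left h3 hc0.le]
  refine ⟨e, c, he1, hc0, ?_, fun f hef hf => (key f hef hf).2⟩
  rw [← sub_eq_zero]
  -- The component of `m e e` orthogonal to `e`; the first-order condition in its own direction
  -- forces it to vanish.
  set w := m e e - c • e with hw
  have hew : ⟪e, w⟫_ℝ = 0 := by
    rw [hw, inner_sub_right, real_inner_smul_right, real_inner_self_eq_norm_sq, he1,
      real_inner_comm, ← hc]
    ring
  by_contra hw0
  have hwn : 0 < ‖w‖ := norm_pos_iff.2 hw0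
  have h1 := (key (‖w‖⁻¹ • w) (by rw [real_inner_smul_right, hew, mul_zero])
    (by simp [norm_smul, hwn.ne'])).1
  rw [real_inner_smul_right] at h1
  have h2 : ⟪m e e, w⟫_ℝ = 0 := by
    rcases mul_eq_zero.1 h1 with h | h
    · exact absurd (inv_eq_zero.1 h) hwn.ne'
    · exact h
  have h3 : ⟪w, w⟫_ℝ = 0 := by
    conv_lhs => arg 2; rw [hw]
    rw [inner_sub_left, real_inner_smul_left, hew, h2]
    ring
  exact hw0 (inner_self_eq_zero.1 h3)

end IsMetrized

end Extremum

/-! ### Compression of operators to the complement of a unit vector, and traces. -/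

section Compression

variable {V : Type*} [NormedAddCommGroup V] [InnerProductSpace ℝ V] {e : V}

theorem finrank_orthogonal_unit {n : ℕ} (he : ‖e‖ = 1) (h : Module.finrank ℝ V = n + 1) :
    Module.finrank ℝ (ℝ ∙ e)ᗮ = n := by
  have : Fact (Module.finrank ℝ V = n + 1) := ⟨h⟩
  exact Submodule.finrank_orthogonal_span_singleton (by rintro rfl; simp at he)

theorem inner_orthogonal_unit (x : (ℝ ∙ e)ᗮ) : ⟪e, (x : V)⟫_ℝ = 0 :=
  Submodule.mem_orthogonal_singleton_iff_inner_right.1 x.2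

variable [FiniteDimensional ℝ V]

/-- The compression of an endomorphism to a subspace. -/
noncomputable def compressEnd (W : Submodule ℝ V) : (V →ₗ[ℝ] V) →ₗ[ℝ] (W →ₗ[ℝ] W) :=
  (LinearMap.lcomp ℝ W W.subtype) ∘ₗ
    LinearMap.llcomp ℝ V V W W.orthogonalProjectionOnto.toLinearMap

/-- The compression of a multiplication to a subspace. -/
noncomputable def compressMul (W : Submodule ℝ V) (m : V →ₗ[ℝ] V →ₗ[ℝ] V) : W →ₗ[ℝ] W →ₗ[ℝ] W :=
  compressEnd W ∘ₗ m ∘ₗ W.subtype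

theorem compressEnd_apply (W : Submodule ℝ V) (T : V →ₗ[ℝ] V) (x : W) :
    compressEnd W T x = W.orthogonalProjectionOnto (T x) := rfl

theorem compressMul_apply (W : Submodule ℝ V) (m : V →ₗ[ℝ] V →ₗ[ℝ] V) (x : W) :
    compressMul W m x = compressEnd W (m x) := rfl

theorem inner_compressEnd (W : Submodule ℝ V) (T : V →ₗ[ℝ] V) (x y : W) :
    ⟪compressEnd W T x, y⟫_ℝ = ⟪T x, (y : V)⟫_ℝ := by
  rw [compressEnd_apply, real_inner_comm, Submodule.inner_orthogonalProjectionOnto_eq_of_mem_left,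
    real_inner_comm]

theorem IsMetrized.compressMul {m : V →ₗ[ℝ] V →ₗ[ℝ] V} (hm : IsMetrized m) (W : Submodule ℝ V) :
    IsMetrized (compressMul W m) where
  comm x y := by
    rw [compressMul_apply, compressMul_apply, compressEnd_apply, compressEnd_apply, hm.comm]
  invariant x y z := by
    rw [compressMul_apply, compressMul_apply, inner_compressEnd, real_inner_comm _ x,
      inner_compressEnd, hm.invariant, real_inner_comm]

theorem compressEnd_isSymmetric (W : Submodule ℝ V) {T : V →ₗ[ℝ] V} (hT : T.IsSymmetric) :
    (compressEnd W T).IsSymmetric := fun x y => by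
  rw [inner_compressEnd, hT, real_inner_comm, ← inner_compressEnd, real_inner_comm]

theorem coe_compressEnd (he : ‖e‖ = 1) (T : V →ₗ[ℝ] V) (x : (ℝ ∙ e)ᗮ) :
    (compressEnd (ℝ ∙ e)ᗮ T x : V) = T x - ⟪e, T x⟫_ℝ • e := by
  rw [compressEnd_apply, ← Submodule.starProjection_apply, Submodule.starProjection_orthogonal,
    _root_.sub_apply, Submodule.starProjection_unit_singleton ℝ he]
  rfl

/-- By cyclicity this is the trace of `T` composed with the projection `1 - e ⊗ e`. -/
theorem trace_compressEnd (he : ‖e‖ = 1) (T : V →ₗ[ℝ] V) :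
    LinearMap.trace ℝ _ (compressEnd (ℝ ∙ e)ᗮ T) = LinearMap.trace ℝ V T - ⟪e, T e⟫_ℝ := by
  have h1 : compressEnd (ℝ ∙ e)ᗮ T
      = (ℝ ∙ e)ᗮ.orthogonalProjectionOnto.toLinearMap ∘ₗ (T ∘ₗ (ℝ ∙ e)ᗮ.subtype) := rfl
  have h2 : (T ∘ₗ (ℝ ∙ e)ᗮ.subtype) ∘ₗ (ℝ ∙ e)ᗮ.orthogonalProjectionOnto.toLinearMap
      = T - (innerₗ V e).smulRight (T e) := by
    ext x
    change T ((ℝ ∙ e)ᗮ.starProjection x) = T x - ⟪e, x⟫_ℝ • T e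
    rw [Submodule.starProjection_orthogonal, _root_.sub_apply,
      Submodule.starProjection_unit_singleton ℝ he, map_sub, map_smul]
    rfl
  rw [h1, ← LinearMap.trace_comp_comm', h2, map_sub, LinearMap.trace_smulRight]
  rfl

theorem trace_compressEnd_comp (he : ‖e‖ = 1) (S T : V →ₗ[ℝ] V) :
    LinearMap.trace ℝ _ (compressEnd (ℝ ∙ e)ᗮ S ∘ₗ compressEnd (ℝ ∙ e)ᗮ T)
      = LinearMap.trace ℝ V (S ∘ₗ T) - ⟪e, S (T e)⟫_ℝ - ⟪e, T (S e)⟫_ℝ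
        + ⟪e, S e⟫_ℝ * ⟪e, T e⟫_ℝ := by
  -- The inner projection `1 - e ⊗ e` subtracts a rank-one operator from `S ∘ T`, which reduces to
  -- the trace of a single compression.
  have h : compressEnd (ℝ ∙ e)ᗮ S ∘ₗ compressEnd (ℝ ∙ e)ᗮ T
      = compressEnd (ℝ ∙ e)ᗮ (S ∘ₗ T - ((innerₗ V e) ∘ₗ T).smulRight (S e)) := by
    refine LinearMap.ext fun x => Subtype.ext ?_
    rw [LinearMap.comp_apply, coe_compressEnd he, coe_compressEnd he, coe_compressEnd he]
    simp [inner_sub_right, real_inner_smul_right]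
  rw [h, trace_compressEnd he, map_sub, LinearMap.trace_smulRight]
  simp only [LinearMap.sub_apply, LinearMap.comp_apply, LinearMap.smulRight_apply, inner_sub_right,
    real_inner_smul_right, innerₗ_apply_apply]
  ring

end Compression

/-! ### The polynomial system for eigenvalues and structure constants. -/

section Coefficients

/-- The identities satisfied by the eigenvalues `a` of multiplication by an idempotent and by the
coefficients `C` of the multiplication compressed to its orthogonal complement, in an eigenbasis. -/
structure IsComplementData {k : ℕ} (κ c : ℝ) (a : Fin k → ℝ) (C : Fin k → Fin k → Fin k → ℝ) :
    Prop where
  swap₁₂ : ∀ i j l, C i j l = C j i l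
  swap₂₃ : ∀ i j l, C i j l = C i l j
  trace_mul : ∀ i, ∑ j, C i j j = 0
  trace_eig_mul : ∀ i, ∑ j, a j * C i j j = 0
  killing : ∀ i i', ∑ j, ∑ l, C i j l * C i' j l = if i = i' then κ - 2 * a i ^ 2 else 0
  sum_eig : ∑ i, a i = -c
  sum_eig_sq : ∑ i, a i ^ 2 = κ - c ^ 2

namespace IsComplementData

theorem perm {k : ℕ} {κ c : ℝ} {a : Fin k → ℝ} {C : Fin k → Fin k → Fin k → ℝ}
    (h : IsComplementData κ c a C) (σ : Equiv.Perm (Fin k)) :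
    IsComplementData κ c (fun i => a (σ i)) (fun i j l => C (σ i) (σ j) (σ l)) where
  swap₁₂ _ _ _ := h.swap₁₂ _ _ _
  swap₂₃ _ _ _ := h.swap₂₃ _ _ _
  trace_mul i := by rw [← h.trace_mul (σ i), Equiv.sum_comp σ fun j => C (σ i) j j]
  trace_eig_mul i := by
    rw [← h.trace_eig_mul (σ i), Equiv.sum_comp σ fun j => a j * C (σ i) j j]
  killing i i' := by
    have h1 := h.killing (σ i) (σ i')
    simp only [σ.injective.eq_iff] at h1
    rw [← h1, ← Equiv.sum_comp σ fun j => ∑ l, C (σ i) j l * C (σ i') j l]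
    exact Finset.sum_congr rfl fun j _ =>
      Equiv.sum_comp σ fun l => C (σ i) (σ j) l * C (σ i') (σ j) l
  sum_eig := by rw [← h.sum_eig, Equiv.sum_comp σ a]
  sum_eig_sq := by rw [← h.sum_eig_sq, Equiv.sum_comp σ fun i => a i ^ 2]

/-- The trace conditions leave two free coefficients, and both diagonal Killing sums equal twice the
sum of their squares. Hence `a 0 ^ 2 = a 1 ^ 2`, and `a 0 + a 1 = -c ≠ 0` excludes opposite signs.
-/
theorem eig_eq_of_two {κ c : ℝ} {a : Fin 2 → ℝ} {C : Fin 2 → Fin 2 → Fin 2 → ℝ}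
    (h : IsComplementData κ c a C) (hc : c ≠ 0) (i : Fin 2) : a i = -(c / 2) := by
  have s1 := h.swap₁₂ 1 0
  have s2 := h.swap₂₃ 0 1 0
  have s3 := h.swap₂₃ 1 1 0
  have t1 := h.trace_mul 0
  have t2 := h.trace_mul 1
  have k1 := h.killing 0 0
  have k2 := h.killing 1 1
  have e1 := h.sum_eig
  simp only [Fin.sum_univ_two, s1, s2, s3, if_true] at t1 t2 k1 k2 e1
  have hp : C 0 1 1 = -C 0 0 0 := by linarith
  have hq : C 1 1 1 = -C 0 0 1 := by linarith
  rw [hp] at k1 k2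
  rw [hq] at k2
  have hsq : (a 0 - a 1) * (a 0 + a 1) = 0 := by nlinarith
  rw [e1] at hsq
  have hd := (mul_eq_zero.1 hsq).resolve_right (neg_ne_zero.2 hc)
  fin_cases i <;> simp <;> linarith

variable {κ c : ℝ} {a : Fin 3 → ℝ} {C : Fin 3 → Fin 3 → Fin 3 → ℝ}

theorem killing_expand (h : IsComplementData κ c a C) (i i' : Fin 3) :
    C i 0 0 * C i' 0 0 + C i 1 1 * C i' 1 1 + C i 2 2 * C i' 2 2
      + 2 * (C i 0 1 * C i' 0 1 + C i 0 2 * C i' 0 2 + C i 1 2 * C i' 1 2)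
      = if i = i' then κ - 2 * a i ^ 2 else 0 := by
  rw [← h.killing i i']
  simp only [Fin.sum_univ_three, h.swap₂₃ _ 1 0, h.swap₂₃ _ 2 0, h.swap₂₃ _ 2 1]
  ring

/-- The normal form of symmetric coefficients with three indices. -/
theorem sorted (h : IsComplementData κ c a C) :
    C 1 0 0 = C 0 0 1 ∧ C 2 0 0 = C 0 0 2 ∧ C 1 0 1 = C 0 1 1 ∧ C 1 0 2 = C 0 1 2 ∧
      C 2 0 1 = C 0 1 2 ∧ C 2 0 2 = C 0 2 2 ∧ C 2 1 1 = C 1 1 2 ∧ C 2 1 2 = C 1 2 2 := by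
  refine ⟨?_, ?_, ?_, ?_, ?_, ?_, ?_, ?_⟩
  · rw [h.swap₁₂, h.swap₂₃]
  · rw [h.swap₁₂, h.swap₂₃]
  · rw [h.swap₁₂]
  · rw [h.swap₁₂]
  · rw [h.swap₁₂, h.swap₂₃]
  · rw [h.swap₁₂]
  · rw [h.swap₁₂, h.swap₂₃]
  · rw [h.swap₁₂]

/-- Comparing plain and weighted traces kills every `C i 0 0`. The off-diagonal Killing identities
then form a linear system in `C 0 1 1` and `C 0 1 2` with determinant a multiple of `C 1 1 1 ^ 2 + C
1 1 2 ^ 2`. The spurious solutions `a 0 = c` and `a 0 = 3 c` are the ones that maximality of `e`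
rules out through `ha`. -/
theorem eq_of_two_eig_eq (h : IsComplementData κ c a C) (hc : 0 < c) (ha : a 0 ≤ c / 2)
    (h12 : a 1 = a 2) (h01 : a 0 ≠ a 1) :
    a 0 = -c ∧ a 1 = 0 ∧ a 2 = 0 ∧ ∀ j l, C 0 j l = 0 := by
  obtain ⟨s1, s2, s3, s4, s5, s6, s7, s8⟩ := h.sorted
  have t0 := h.trace_mul 0
  have t1 := h.trace_mul 1
  have t2 := h.trace_mul 2
  have u0 := h.trace_eig_mul 0
  have u1 := h.trace_eig_mul 1
  have u2 := h.trace_eig_mul 2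
  have q00 := h.killing_expand 0 0
  have q11 := h.killing_expand 1 1
  have q01 := h.killing_expand 0 1
  have q02 := h.killing_expand 0 2
  have e1 := h.sum_eig
  have e2 := h.sum_eig_sq
  simp only [Fin.sum_univ_three, s1, s2, s3, s4, s5, s6, s7, s8, ← h12, if_true,
    (by decide : (0 : Fin 3) ≠ 1), (by decide : (0 : Fin 3) ≠ 2), if_false]
    at t0 t1 t2 u0 u1 u2 q00 q11 q01 q02 e1 e2
  have hd : a 0 - a 1 ≠ 0 := sub_ne_zero.2 h01
  have z0 : C 0 0 0 = 0 := mul_left_cancel₀ hd (by linear_combination u0 - a 1 * t0)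
  have z1 : C 0 0 1 = 0 := mul_left_cancel₀ hd (by linear_combination u1 - a 1 * t1)
  have z2 : C 0 0 2 = 0 := mul_left_cancel₀ hd (by linear_combination u2 - a 1 * t2)
  have w0 : C 0 2 2 = -C 0 1 1 := by linarith
  have w1 : C 1 2 2 = -C 1 1 1 := by linarith
  have w2 : C 2 2 2 = -C 1 1 2 := by linarith
  rw [z0, z1, z2, w0] at q00
  rw [z1, w1] at q11
  rw [z0, z1, z2, w0, w1] at q01
  rw [z0, z1, z2, w0, w1, w2] at q02
  have hx : C 0 1 1 * (C 1 1 1 ^ 2 + C 1 1 2 ^ 2) = 0 := by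
    linear_combination C 1 1 1 / 2 * q01 + C 1 1 2 / 2 * q02
  have hy : C 0 1 2 * (C 1 1 1 ^ 2 + C 1 1 2 ^ 2) = 0 := by
    linear_combination C 1 1 2 / 2 * q01 - C 1 1 1 / 2 * q02
  by_cases hr : C 1 1 1 ^ 2 + C 1 1 2 ^ 2 = 0
  · exfalso
    have hsq : (a 0 - a 1) * (a 0 + a 1) = 0 := by linear_combination (q00 - q11) / 2 + hr
    have := (mul_eq_zero.1 hsq).resolve_left hd
    -- Here `a 1 = -a 0`, so the eigenvalue sum gives `a 0 = c > c / 2`.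
    linarith
  have x0 := (mul_eq_zero.1 hx).resolve_right hr
  have y0 := (mul_eq_zero.1 hy).resolve_right hr
  rw [x0, y0] at q00
  have ha0 : a 0 = -c - 2 * a 1 := by linarith
  have hm : a 1 * (a 1 + 2 * c) = 0 := by
    rw [ha0] at q00 e2
    linear_combination (e2 - q00) / 2 * (-1)
  rcases mul_eq_zero.1 hm with h1 | h1
  · refine ⟨by linarith, h1, h12 ▸ h1, fun j l => ?_⟩
    have v1 := h.swap₂₃ 0 1 0
    have v2 := h.swap₂₃ 0 2 0
    have v3 := h.swap₂₃ 0 2 1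
    fin_cases j <;> fin_cases l <;> simp [*]
  -- Here `a 1 = -2 c`, so `a 0 = 3 c > c / 2`.
  · linarith

/-- A vector orthogonal to `(1, 1, 1)` and `(a₀, a₁, a₂)` is a multiple of their cross product. -/
theorem exists_smul_of_orthogonal {a₀ a₁ a₂ x y z : ℝ} (hne : a₁ ≠ a₂) (h : x + y + z = 0)
    (h' : a₀ * x + a₁ * y + a₂ * z = 0) :
    ∃ t, x = t * (a₁ - a₂) ∧ y = t * (a₂ - a₀) ∧ z = t * (a₀ - a₁) := by
  have hd : a₁ - a₂ ≠ 0 := sub_ne_zero.2 hne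
  refine ⟨x / (a₁ - a₂), ?_, ?_, ?_⟩
  · field_simp
  · field_simp
    linear_combination h' - a₂ * h
  · field_simp
    linear_combination a₁ * h - h'

/-- The case where one cross-product parameter `t` accounts for all the structure constants.
Eliminating `t ^ 2` gives a cubic that factors over the rationals, and each root makes two
eigenvalues coincide. -/
theorem false_of_single {a₀ a₁ a₂ t : ℝ} (h01 : a₀ ≠ a₁) (h02 : a₀ ≠ a₂) (h12 : a₁ ≠ a₂)
    (hsum : a₀ + a₁ + a₂ = -c) (hsq : a₀ ^ 2 + a₁ ^ 2 + a₂ ^ 2 = κ - c ^ 2)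
    (q0 : t ^ 2 * ((a₁ - a₂) ^ 2 + (a₂ - a₀) ^ 2 + (a₀ - a₁) ^ 2) = κ - 2 * a₀ ^ 2)
    (q1 : 2 * t ^ 2 * (a₂ - a₀) ^ 2 = κ - 2 * a₁ ^ 2)
    (q2 : 2 * t ^ 2 * (a₀ - a₁) ^ 2 = κ - 2 * a₂ ^ 2) : False := by
  -- Coordinates adapted to the symmetry exchanging `a₁` and `a₂`, which only changes the sign of
  -- `d`.
  obtain ⟨s, hs⟩ : ∃ s, s = a₁ + a₂ := ⟨_, rfl⟩
  obtain ⟨d, hd⟩ : ∃ d, d = a₁ - a₂ := ⟨_, rfl⟩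
  obtain ⟨u, hu⟩ : ∃ u, u = 2 * a₀ - s := ⟨_, rfl⟩
  obtain rfl : a₁ = (s + d) / 2 := by linarith
  obtain rfl : a₂ = (s - d) / 2 := by linarith
  obtain rfl : a₀ = (u + s) / 2 := by linarith
  obtain rfl : c = -(u + 3 * s) / 2 := by linarith
  obtain rfl : κ = (u ^ 2 + 4 * u * s + 6 * s ^ 2 + d ^ 2) / 2 := by linarith
  have hd0 : d ≠ 0 := by
    rintro rfl
    exact h12 (by ring)
  have h1 : t ^ 2 * u = -s := mul_left_cancel₀ hd0 (by linear_combination (q1 - q2) / 2)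
  have h2 : t ^ 2 * d ^ 2 = u ^ 2 + 5 * u * s + 5 * s ^ 2 := by
    linear_combination q1 + q2 - u * h1
  have h3 : d ^ 2 = 3 * u ^ 2 + 12 * u * s + 10 * s ^ 2 := by
    linear_combination -2 * q0 + u * h1 + 3 * h2
  have h4 : (u + s) * ((u + 2 * s) * (u + 5 * s)) = 0 := by
    linear_combination -u * h2 + d ^ 2 * h1 - s * h3
  rcases mul_eq_zero.1 h4 with h | h
  · obtain rfl : u = -s := by linarith
    have h5 : (d - s) * (d + s) = 0 := by linear_combination h3
    rcases mul_eq_zero.1 h5 with h | h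
    · exact h02 (by linarith)
    · exact h01 (by linarith)
  rcases mul_eq_zero.1 h with h | h
  · obtain rfl : u = -2 * s := by linarith
    exact hd0 (pow_eq_zero_iff two_ne_zero |>.1 (by nlinarith [sq_nonneg s, sq_nonneg d]))
  · obtain rfl : u = -5 * s := by linarith
    have h5 : (d - 5 * s) * (d + 5 * s) = 0 := by linear_combination h3
    rcases mul_eq_zero.1 h5 with h | h
    · exact h02 (by linarith)
    · exact h01 (by linarith)

/-- With distinct eigenvalues, both trace conditions reduce `C` to three cross-product parameters
`t`, `t'`, `t''` and the coefficient `d = C 0 1 2`, tied together by the off-diagonal Killing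
identities. -/
theorem false_of_injective (h : IsComplementData κ c a C) (h01 : a 0 ≠ a 1) (h02 : a 0 ≠ a 2)
    (h12 : a 1 ≠ a 2) : False := by
  obtain ⟨s1, s2, s3, s4, s5, s6, s7, s8⟩ := h.sorted
  have t0 := h.trace_mul 0
  have t1 := h.trace_mul 1
  have t2 := h.trace_mul 2
  have u0 := h.trace_eig_mul 0
  have u1 := h.trace_eig_mul 1
  have u2 := h.trace_eig_mul 2
  have q00 := h.killing_expand 0 0
  have q11 := h.killing_expand 1 1
  have q22 := h.killing_expand 2 2
  have q01 := h.killing_expand 0 1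
  have q02 := h.killing_expand 0 2
  have q12 := h.killing_expand 1 2
  have e1 := h.sum_eig
  have e2 := h.sum_eig_sq
  simp only [Fin.sum_univ_three, s1, s2, s3, s4, s5, s6, s7, s8, if_true,
    (by decide : (0 : Fin 3) ≠ 1), (by decide : (0 : Fin 3) ≠ 2), (by decide : (1 : Fin 3) ≠ 2),
    if_false] at t0 t1 t2 u0 u1 u2 q00 q11 q22 q01 q02 q12 e1 e2
  obtain ⟨t, x1, x2, x3⟩ := exists_smul_of_orthogonal h12 t0 u0
  obtain ⟨t', y1, y2, y3⟩ := exists_smul_of_orthogonal h12 t1 u1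
  obtain ⟨t'', z1, z2, z3⟩ := exists_smul_of_orthogonal h12 t2 u2
  simp only [x1, x2, x3, y1, y2, y3, z1, z2, z3] at q00 q11 q22 q01 q02 q12
  generalize C 0 1 2 = d at *
  clear s1 s2 s3 s4 s5 s6 s7 s8 t0 t1 t2 u0 u1 u2 x1 x2 x3 y1 y2 y3 z1 z2 z3 h
  generalize a 0 = a₀ at *
  generalize a 1 = a₁ at *
  generalize a 2 = a₂ at *
  have n0 : a₁ - a₂ ≠ 0 := sub_ne_zero.2 h12
  have n1 : a₂ - a₀ ≠ 0 := sub_ne_zero.2 h02.symm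
  have n2 : a₀ - a₁ ≠ 0 := sub_ne_zero.2 h01
  have r01 : t * t' * (a₀ - a₁) = d * t'' :=
    mul_left_cancel₀ n2 (by linear_combination q01 / 2)
  have r02 : t * t'' * (a₂ - a₀) = d * t' :=
    mul_left_cancel₀ n1 (by linear_combination q02 / 2)
  have r12 : t' * t'' * (a₁ - a₂) = d * t :=
    mul_left_cancel₀ n0 (by linear_combination q12 / 2)
  by_cases hd : d = 0
  · subst hd
    -- For `d = 0` all pairwise products of the parameters vanish, so at most one is nonzero; cyclic
    -- relabelling covers the three choices.
    simp only [zero_mul, mul_eq_zero, n0, n1, n2, or_false] at r01 r02 r12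
    by_cases ht : t = 0
    · subst ht
      rcases r12 with rfl | rfl
      · exact false_of_single (κ := κ) (c := c) (t := t'') h02.symm h12.symm h01 (by linarith) (by linarith)
          (by linear_combination q22) (by linear_combination q00) (by linear_combination q11)
      · exact false_of_single (κ := κ) (c := c) (t := t') h12 h01.symm h02.symm (by linarith) (by linarith)
          (by linear_combination q11) (by linear_combination q22) (by linear_combination q00)
    · obtain rfl := r01.resolve_left ht
      obtain rfl := r02.resolve_left ht
      exact false_of_single (κ := κ) (c := c) (t := t) h01 h02 h12 (by linarith) (by linarith)
        (by linear_combination q00) (by linear_combination q11) (by linear_combination q22)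
  · by_cases hall : t = 0 ∧ t' = 0 ∧ t'' = 0
    · obtain ⟨rfl, rfl, rfl⟩ := hall
      have p1 : (a₀ - a₁) * (a₀ + a₁) = 0 := by linear_combination (q00 - q11) / 2
      have p2 : (a₀ - a₂) * (a₀ + a₂) = 0 := by linear_combination (q00 - q22) / 2
      have p3 := (mul_eq_zero.1 p1).resolve_left n2
      have p4 := (mul_eq_zero.1 p2).resolve_left (sub_ne_zero.2 h02)
      exact h12 (by linarith)
    -- For `d ≠ 0`, if one parameter vanishes then all do.
    · have ht : t ≠ 0 := by
        rintro rfl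
        simp_all
      have ht' : t' ≠ 0 := by
        rintro rfl
        simp_all
      have ht'' : t'' ≠ 0 := by
        rintro rfl
        simp_all
      have m0 : t ^ 2 * ((a₀ - a₁) * (a₂ - a₀)) = d ^ 2 :=
        mul_left_cancel₀ (mul_ne_zero ht' ht'')
          (by linear_combination t * t'' * (a₂ - a₀) * r01 + d * t'' * r02)
      have m1 : t' ^ 2 * ((a₀ - a₁) * (a₁ - a₂)) = d ^ 2 :=
        mul_left_cancel₀ (mul_ne_zero ht ht'')
          (by linear_combination t' * t'' * (a₁ - a₂) * r01 + d * t'' * r12)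
      have dp : 0 < d ^ 2 := by positivity
      have g0 : 0 < (a₀ - a₁) * (a₂ - a₀) := pos_of_mul_pos_right (m0 ▸ dp) (sq_nonneg t)
      have g1 : 0 < (a₀ - a₁) * (a₁ - a₂) := pos_of_mul_pos_right (m1 ▸ dp) (sq_nonneg t')
      -- The positive quantities in `g0` and `g1` add up to `-(a₀ - a₁) ^ 2`.
      nlinarith [sq_nonneg (a₀ - a₁)]

/-- In dimension three either multiplication by the idempotent is scalar on the complement, or
some eigenvector splits off. -/
theorem eig_eq_or_exists (h : IsComplementData κ c a C) (hc : 0 < c) (ha : ∀ i, a i ≤ c / 2) :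
    (∀ i, a i = -(c / 3)) ∨
      ∃ i, a i = -c ∧ (∀ j, j ≠ i → a j = 0) ∧ ∀ j l, C i j l = 0 := by
  have key (σ : Equiv.Perm (Fin 3)) (h12 : a (σ 1) = a (σ 2)) (h01 : a (σ 0) ≠ a (σ 1)) :
      ∃ i, a i = -c ∧ (∀ j, j ≠ i → a j = 0) ∧ ∀ j l, C i j l = 0 := by
    obtain ⟨p1, p2, p3, p4⟩ := (h.perm σ).eq_of_two_eig_eq hc (ha _) h12 h01
    refine ⟨σ 0, p1, fun j hj => ?_, fun j l => ?_⟩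
    · obtain ⟨j, rfl⟩ := σ.surjective j
      fin_cases j
      · exact absurd rfl hj
      · exact p2
      · exact p3
    · simpa using p4 (σ.symm j) (σ.symm l)
  by_cases h01 : a 0 = a 1
  · by_cases h02 : a 0 = a 2
    · left
      have e1 := h.sum_eig
      rw [Fin.sum_univ_three] at e1
      intro i
      fin_cases i <;> simp <;> linarith
    · right
      have e0 : Equiv.swap (0 : Fin 3) 2 0 = 2 := rfl
      have e1 : Equiv.swap (0 : Fin 3) 2 1 = 1 := rfl
      have e2 : Equiv.swap (0 : Fin 3) 2 2 = 0 := rfl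
      refine key (Equiv.swap 0 2) ?_ ?_
      · rw [e1, e2, h01]
      · rw [e0, e1, ← h01]
        exact Ne.symm h02
  · right
    by_cases h02 : a 0 = a 2
    · have e0 : Equiv.swap (0 : Fin 3) 1 0 = 1 := rfl
      have e1 : Equiv.swap (0 : Fin 3) 1 1 = 0 := rfl
      have e2 : Equiv.swap (0 : Fin 3) 1 2 = 2 := rfl
      refine key (Equiv.swap 0 1) ?_ ?_
      · rw [e1, e2, h02]
      · rw [e0, e1]
        exact Ne.symm h01
    · by_cases h12 : a 1 = a 2
      · exact key 1 h12 h01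
      · exact (h.false_of_injective h01 h02 h12).elim

end IsComplementData

end Coefficients

/-! ### From the algebra to the polynomial system. -/

section KillingSpace

variable {V : Type*} [NormedAddCommGroup V] [InnerProductSpace ℝ V]
  {m : V →ₗ[ℝ] V →ₗ[ℝ] V} {κ c : ℝ} {e : V}

/-- A metrized multiplication with trace-free multiplication operators whose Killing form is `κ`
times the inner product. -/
structure IsKillingSpace (m : V →ₗ[ℝ] V →ₗ[ℝ] V) (κ : ℝ) : Prop extends IsMetrized m where
  exact : ∀ x, LinearMap.trace ℝ V (m x) = 0
  killing : ∀ x y, LinearMap.trace ℝ V (m x ∘ₗ m y) = κ * ⟪x, y⟫_ℝ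

/-- The vectors `v i` are nonzero idempotents summing to zero and satisfying the relations of the
simplicial algebra. -/
structure IsSimplex {V : Type*} [AddCommGroup V] [Module ℝ V] (m : V →ₗ[ℝ] V →ₗ[ℝ] V) {n : ℕ}
    (v : Fin (n + 1) → V) : Prop where
  ne_zero : ∀ i, v i ≠ 0
  sum_eq_zero : ∑ i, v i = 0
  mul_self : ∀ i, m (v i) (v i) = v i
  mul_of_ne : ∀ i j, i ≠ j → m (v i) (v j) = (-1 / ((n : ℝ) - 1)) • (v i + v j)

/-- There is a simplex of idempotents whose norms are the ones prescribed by the Killing form. -/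
def HasSimplex (n : ℕ) (m : V →ₗ[ℝ] V →ₗ[ℝ] V) (κ : ℝ) : Prop :=
  ∃ v : Fin (n + 1) → V, IsSimplex m v ∧ ∀ i, κ * ⟪v i, v i⟫_ℝ = n / ((n : ℝ) - 1)

namespace IsMetrized

theorem inner_mul_unit (hm : IsMetrized m) (he : m e e = c • e) (x : (ℝ ∙ e)ᗮ) :
    ⟪e, m e x⟫_ℝ = 0 := by
  rw [← hm.inner_left, he, real_inner_smul_left, inner_orthogonal_unit, mul_zero]

theorem inner_unit_mul (hm : IsMetrized m) (x y : V) : ⟪e, m x y⟫_ℝ = ⟪m e x, y⟫_ℝ := by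
  rw [hm.invariant]

variable [FiniteDimensional ℝ V]

theorem coe_compressEnd_mul (hm : IsMetrized m) (hn : ‖e‖ = 1) (he : m e e = c • e)
    (x : (ℝ ∙ e)ᗮ) : (compressEnd (ℝ ∙ e)ᗮ (m e) x : V) = m e x := by
  rw [coe_compressEnd hn, hm.inner_mul_unit he, zero_smul, sub_zero]

theorem mul_eq_compressMul_add (hm : IsMetrized m) (hn : ‖e‖ = 1) (x y : (ℝ ∙ e)ᗮ) :
    m x y = (_root_.compressMul (ℝ ∙ e)ᗮ m x y : V) + ⟪m e x, y⟫_ℝ • e := by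
  rw [compressMul_apply, coe_compressEnd hn, hm.inner_unit_mul, sub_add_cancel]

theorem trace_compressMul (hm : IsMetrized m) (hn : ‖e‖ = 1) (he : m e e = c • e) (x : (ℝ ∙ e)ᗮ) :
    LinearMap.trace ℝ _ (_root_.compressMul (ℝ ∙ e)ᗮ m x) = LinearMap.trace ℝ V (m x) := by
  rw [compressMul_apply, trace_compressEnd hn, hm.comm, hm.inner_mul_unit he, sub_zero]

theorem trace_compressMul_comp (hm : IsMetrized m) (hn : ‖e‖ = 1) (he : m e e = c • e)
    (x y : (ℝ ∙ e)ᗮ) :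
    LinearMap.trace ℝ _ (_root_.compressMul (ℝ ∙ e)ᗮ m x ∘ₗ _root_.compressMul (ℝ ∙ e)ᗮ m y)
      = LinearMap.trace ℝ V (m x ∘ₗ m y) - 2 * ⟪m e x, m e y⟫_ℝ := by
  rw [compressMul_apply, compressMul_apply, trace_compressEnd_comp hn, hm.comm y e, hm.comm x e,
    hm.inner_mul_unit he, hm.inner_unit_mul x, hm.inner_unit_mul y, real_inner_comm (m e x)]
  ring

end IsMetrized

namespace IsKillingSpace

theorem ne_zero [FiniteDimensional ℝ V] [Nontrivial V] (hm : IsKillingSpace m κ) (hκ : 0 < κ) :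
    m ≠ 0 := by
  rintro rfl
  obtain ⟨x, hx⟩ := exists_ne (0 : V)
  have h := hm.killing x x
  simp only [LinearMap.zero_apply, LinearMap.comp_zero, map_zero] at h
  rcases mul_eq_zero.1 h.symm with h | h
  · exact hκ.ne' h
  · exact hx (inner_self_eq_zero.1 h)

variable [FiniteDimensional ℝ V]

/-- The basis diagonalizes `m e` on the complement of `e`. Each identity is an exactness or Killing
trace on `V`, rewritten on the complement by the trace formulas for compressions. -/
theorem exists_complementData {k : ℕ} (hm : IsKillingSpace m κ) (hn : ‖e‖ = 1)
    (he : m e e = c • e) (hV : Module.finrank ℝ V = k + 1) :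
    ∃ (b : OrthonormalBasis (Fin k) ℝ (ℝ ∙ e)ᗮ) (a : Fin k → ℝ),
      (∀ i, m e (b i) = a i • (b i : V)) ∧
      IsComplementData κ c a fun i j l => ⟪compressMul (ℝ ∙ e)ᗮ m (b i) (b j), b l⟫_ℝ := by
  have hA := compressEnd_isSymmetric (ℝ ∙ e)ᗮ (hm.isSymmetric e)
  have hW := finrank_orthogonal_unit hn hV
  have hm' := hm.toIsMetrized.compressMul (ℝ ∙ e)ᗮ
  obtain ⟨b, hb⟩ : ∃ b, b = hA.eigenvectorBasis hW := ⟨_, rfl⟩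
  obtain ⟨a, ha⟩ : ∃ a, a = hA.eigenvalues hW := ⟨_, rfl⟩
  have hAb (i : Fin k) : compressEnd (ℝ ∙ e)ᗮ (m e) (b i) = a i • b i := by
    rw [ha, hb]
    exact hA.apply_eigenvectorBasis hW i
  have hmb (i : Fin k) : m e (b i) = a i • (b i : V) := by
    rw [← hm.coe_compressEnd_mul hn he, hAb]
    rfl
  have hee : ⟪e, e⟫_ℝ = 1 := by rw [real_inner_self_eq_norm_sq, hn, one_pow]
  refine ⟨b, a, hmb, ?_, ?_, ?_, ?_, ?_, ?_, ?_⟩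
  · intro i j l
    rw [hm'.comm]
  · intro i j l
    rw [hm'.inner_swap]
  · intro i
    have h := hm.trace_compressMul hn he (b i)
    rw [hm.exact, LinearMap.trace_eq_sum_inner _ b] at h
    simpa only [real_inner_comm] using h
  · intro i
    -- The weighted trace vanishes because `e` and `b i` are Killing-orthogonal.
    have h := trace_compressEnd_comp hn (m e) (m (b i))
    rw [hm.killing, inner_orthogonal_unit, hm.comm (b i) e, hm.inner_mul_unit he, hmb, he,
      map_smul, map_smul, real_inner_smul_right, real_inner_smul_right, hm.comm (b i) e,
      hm.inner_mul_unit he, LinearMap.trace_eq_sum_inner _ b] at h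
    simp only [LinearMap.comp_apply, mul_zero, sub_zero, add_zero] at h
    rw [← h]
    refine Finset.sum_congr rfl fun j _ => ?_
    rw [← compressEnd_isSymmetric (ℝ ∙ e)ᗮ (hm.isSymmetric e), hAb, real_inner_smul_left,
      real_inner_comm, compressMul_apply]
  · intro i i'
    have h := hm.trace_compressMul_comp hn he (b i) (b i')
    rw [hm.killing, LinearMap.trace_eq_sum_inner _ b, hmb, hmb, real_inner_smul_left,
      real_inner_smul_right, ← Submodule.coe_inner, b.inner_eq_ite] at h
    have h' : κ * (if i = i' then (1 : ℝ) else 0)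
        - 2 * (a i * (a i' * if i = i' then (1 : ℝ) else 0))
        = if i = i' then κ - 2 * a i ^ 2 else 0 := by
      split_ifs with hi
      · rw [hi]
        ring
      · ring
    rw [← h', ← h]
    refine Finset.sum_congr rfl fun j _ => ?_
    rw [LinearMap.comp_apply, ← hm'.inner_left, ← b.sum_inner_mul_inner]
    simp only [real_inner_comm]
  · have h := trace_compressEnd hn (m e)
    rw [hm.exact, he, real_inner_smul_right, hee, LinearMap.trace_eq_sum_inner _ b] at h
    simp only [hAb, real_inner_smul_right, b.inner_eq_one, mul_one, zero_sub] at h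
    exact h
  · have h := trace_compressEnd_comp hn (m e) (m e)
    rw [hm.killing, he, map_smul, he, LinearMap.trace_eq_sum_inner _ b] at h
    simp only [LinearMap.comp_apply, hAb, map_smul, real_inner_smul_right, b.inner_eq_one, hee,
      mul_one] at h
    simp only [pow_two, h]
    ring

end IsKillingSpace

end KillingSpace

/-! ### Construction of simplices of idempotents. -/

section Simplices

variable {V : Type*} [NormedAddCommGroup V] [InnerProductSpace ℝ V]
  {m : V →ₗ[ℝ] V →ₗ[ℝ] V} {κ c : ℝ} {e : V}

theorem mul_inv_smul_self (hc : c ≠ 0) (he : m e e = c • e) :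
    m (c⁻¹ • e) (c⁻¹ • e) = c⁻¹ • e := by
  rw [map_smul, map_smul, LinearMap.smul_apply, he, inv_smul_smul₀ hc]

/-- With `e` and `f` as `1` and `i`, the product is `c` times the conjugate of complex
multiplication. Its nonzero idempotents are the three cube roots of unity divided by `c`. -/
theorem exists_isSimplex_two (hm : ∀ x y, m x y = m y x) {f : V} (hc : c ≠ 0) (hn : ‖e‖ = 1)
    (hf : ‖f‖ = 1) (hef : ⟪e, f⟫_ℝ = 0) (hee : m e e = c • e) (hmef : m e f = -c • f)
    (hff : m f f = -c • e) :
    ∃ v : Fin (2 + 1) → V, IsSimplex m v ∧ (∀ i, c ^ 2 * ⟪v i, v i⟫_ℝ = 1) ∧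
      ∀ i, v i ∈ Submodule.span ℝ {e, f} := by
  have h3 : √3 * √3 = (3 : ℝ) := Real.mul_self_sqrt (by norm_num)
  obtain ⟨E, hE⟩ : ∃ E, E = c⁻¹ • e := ⟨_, rfl⟩
  obtain ⟨F, hF⟩ : ∃ F, F = (√3 / 2 * c⁻¹) • f := ⟨_, rfl⟩
  have hEE : m E E = E := by rw [hE, mul_inv_smul_self hc hee]
  have hEF : m E F = -F := by
    rw [hE, hF, map_smul, map_smul, LinearMap.smul_apply, hmef]
    match_scalars
    field_simp
  have hFF : m F F = (-(3 / 4) : ℝ) • E := by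
    rw [hE, hF, map_smul, map_smul, LinearMap.smul_apply, hff]
    match_scalars
    field_simp
    linear_combination -4 * h3
  have hFE : m F E = -F := by rw [hm, hEF]
  have hEn : c ^ 2 * ⟪E, E⟫_ℝ = 1 := by
    rw [hE, real_inner_smul_left, real_inner_smul_right, real_inner_self_eq_norm_sq, hn]
    field_simp
  have hFn : c ^ 2 * ⟪F, F⟫_ℝ = 3 / 4 := by
    rw [hF, real_inner_smul_left, real_inner_smul_right, real_inner_self_eq_norm_sq, hf]
    field_simp
    linear_combination 4 * h3
  have hEFn : ⟪E, F⟫_ℝ = 0 := by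
    rw [hE, hF, real_inner_smul_left, real_inner_smul_right, hef, mul_zero, mul_zero]
  have hFEn : ⟪F, E⟫_ℝ = 0 := by rw [real_inner_comm, hEFn]
  have hEs : E ∈ Submodule.span ℝ {e, f} :=
    hE ▸ Submodule.smul_mem _ _ (Submodule.subset_span (by simp))
  have hFs : F ∈ Submodule.span ℝ {e, f} :=
    hF ▸ Submodule.smul_mem _ _ (Submodule.subset_span (by simp))
  have hnorm (i : Fin (2 + 1)) :
      c ^ 2 * ⟪(![E, (-(1 / 2) : ℝ) • E + F, (-(1 / 2) : ℝ) • E - F] : Fin (2 + 1) → V) i,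
        (![E, (-(1 / 2) : ℝ) • E + F, (-(1 / 2) : ℝ) • E - F] : Fin (2 + 1) → V) i⟫_ℝ = 1 := by
    fin_cases i
    · simpa using hEn
    · change c ^ 2 * ⟪(-(1 / 2) : ℝ) • E + F, (-(1 / 2) : ℝ) • E + F⟫_ℝ = 1
      simp only [inner_add_left, inner_add_right, real_inner_smul_left, real_inner_smul_right, hEFn,
        hFEn]
      linear_combination 1 / 4 * hEn + hFn
    · change c ^ 2 * ⟪(-(1 / 2) : ℝ) • E - F, (-(1 / 2) : ℝ) • E - F⟫_ℝ = 1
      simp only [inner_sub_left, inner_sub_right, real_inner_smul_left, real_inner_smul_right, hEFn,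
        hFEn]
      linear_combination 1 / 4 * hEn + hFn
  refine ⟨![E, (-(1 / 2) : ℝ) • E + F, (-(1 / 2) : ℝ) • E - F], ⟨fun i hi => ?_, ?_, ?_, ?_⟩,
    hnorm, ?_⟩
  · have := hnorm i
    rw [hi, inner_zero_left, mul_zero] at this
    exact zero_ne_one this
  · simp [Fin.sum_univ_succ]
    module
  · intro i
    fin_cases i
    · exact hEE
    · simp [hEE, hEF, hFE, hFF]
      module
    · simp [hEE, hEF, hFE, hFF]
      module
  · intro i j hij
    have hα : (-1 / (((2 : ℕ) : ℝ) - 1)) = -1 := by norm_num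
    rw [hα]
    fin_cases i <;> fin_cases j <;> first | exact absurd rfl hij | skip
    all_goals
      simp [hEE, hEF, hFE, hFF]
      module
  · intro i
    fin_cases i
    · exact hEs
    · exact Submodule.add_mem _ (Submodule.smul_mem _ _ hEs) hFs
    · exact Submodule.sub_mem _ (Submodule.smul_mem _ _ hEs) hFs

variable [FiniteDimensional ℝ V]

namespace IsKillingSpace

/-- If multiplication by the unit vector `e` is scalar on the complement of `e`, the compressed
multiplication is again of Killing type. -/
theorem compressMul_of_scalar {s : ℝ} (hm : IsKillingSpace m κ) (hn : ‖e‖ = 1) (he : m e e = c • e)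
    (hs : ∀ x : (ℝ ∙ e)ᗮ, m e x = s • (x : V)) :
    IsKillingSpace (compressMul (ℝ ∙ e)ᗮ m) (κ - 2 * s ^ 2) where
  toIsMetrized := hm.toIsMetrized.compressMul _
  exact x := by rw [hm.trace_compressMul hn he, hm.exact]
  killing x y := by
    rw [hm.trace_compressMul_comp hn he, hm.killing, hs, hs, real_inner_smul_left,
      real_inner_smul_right, Submodule.coe_inner]
    ring

/-- Cone over a regular simplex: the new vertex is `E = e / c`, and the old vertices are rescaled
and pushed down along `E`. The norms recorded in `HasSimplex` fix the scale and the `E`-components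
of the products. -/
theorem hasSimplex_succ {k : ℕ} (hk : 2 ≤ k) (hm : IsKillingSpace m κ) (hn : ‖e‖ = 1) (hc : c ≠ 0)
    (he : m e e = c • e) (hs : ∀ x : (ℝ ∙ e)ᗮ, m e x = (-(c / k)) • (x : V))
    (hκ : κ = c ^ 2 * (k + 1) / k)
    (ih : HasSimplex k (compressMul (ℝ ∙ e)ᗮ m) (κ - 2 * (-(c / k)) ^ 2)) :
    HasSimplex (k + 1) m κ := by
  obtain ⟨u, hu, hun⟩ := ih
  have hm' := hm.toIsMetrized.compressMul (ℝ ∙ e)ᗮ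
  have hα : ((k + 1 : ℕ) : ℝ) - 1 = k := by push_cast; ring
  have hcast : ((k + 1 : ℕ) : ℝ) = k + 1 := by push_cast; ring
  have humne := hu.mul_of_ne
  have hk' : (2 : ℝ) ≤ k := by exact_mod_cast hk
  simp only [HasSimplex, hcast]
  generalize (k : ℝ) = K at *
  have hK0 : K ≠ 0 := by positivity
  have hK1 : K - 1 ≠ 0 := by linarith
  have hK2 : K + 2 ≠ 0 := by positivity
  have hK3 : K + 1 ≠ 0 := by positivity
  have hun' (i : Fin (k + 1)) : c ^ 2 * ⟪u i, u i⟫_ℝ = K ^ 3 / ((K - 1) ^ 2 * (K + 2)) := by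
    have h := hun i
    rw [hκ] at h
    field_simp at h ⊢
    linear_combination h
  have hune (i j : Fin (k + 1)) (hij : i ≠ j) :
      c ^ 2 * ⟪u i, u j⟫_ℝ = -K ^ 2 / ((K - 1) ^ 2 * (K + 2)) := by
    -- Invariance and idempotency give the regular-simplex relation `⟪u i, u j⟫ = -⟪u i, u i⟫ / K`.
    have h1 := hm'.invariant (u i) (u i) (u j)
    have h2 := hun' i
    rw [hu.mul_self, humne i j hij, real_inner_smul_right, inner_add_right] at h1
    have h3 : K * (c ^ 2 * ⟪u i, u j⟫_ℝ) = -(c ^ 2 * ⟪u i, u i⟫_ℝ) := by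
      field_simp at h1
      linear_combination c ^ 2 * h1
    rw [h2] at h3
    refine mul_left_cancel₀ hK0 (h3.trans ?_)
    field_simp
  obtain ⟨E, hE⟩ : ∃ E, E = c⁻¹ • e := ⟨_, rfl⟩
  have hEE : m E E = E := by rw [hE, mul_inv_smul_self hc he]
  have hEu (i : Fin (k + 1)) : m E (u i) = (-1 / K) • (u i : V) := by
    rw [hE, map_smul, LinearMap.smul_apply, hs, smul_smul]
    congr 1
    field_simp
  have huE (i : Fin (k + 1)) : m (u i) E = (-1 / K) • (u i : V) := by rw [hm.comm, hEu]
  have huu (i j : Fin (k + 1)) : m (u i) (u j)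
      = (compressMul (ℝ ∙ e)ᗮ m (u i) (u j) : V) + (-(c ^ 2 * ⟪u i, u j⟫_ℝ) / K) • E := by
    rw [hm.mul_eq_compressMul_add hn, hs, real_inner_smul_left, Submodule.coe_inner, hE, smul_smul]
    congr 2
    field_simp
  have hEn : c ^ 2 * ⟪E, E⟫_ℝ = 1 := by
    rw [hE, real_inner_smul_left, real_inner_smul_right, real_inner_self_eq_norm_sq, hn]
    field_simp
  have hEun (i : Fin (k + 1)) : ⟪E, (u i : V)⟫_ℝ = 0 := by
    rw [hE, real_inner_smul_left, inner_orthogonal_unit, mul_zero]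
  -- The shift `-1 / (K + 1)` makes the vertices sum to zero; `β` then gives all of them the norm of
  -- `E`.
  obtain ⟨β, hβ⟩ : ∃ β, β = (K - 1) * (K + 2) / (K * (K + 1)) := ⟨_, rfl⟩
  obtain ⟨v, hv⟩ : ∃ v : Fin (k + 1 + 1) → V,
      v = Fin.cons E fun i => (-1 / (K + 1)) • E + β • (u i : V) := ⟨_, rfl⟩
  have hv0 : v 0 = E := by rw [hv, Fin.cons_zero]
  have hvs (i : Fin (k + 1)) : v i.succ = (-1 / (K + 1)) • E + β • (u i : V) := by
    rw [hv, Fin.cons_succ]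
  have hnorm (i : Fin (k + 1 + 1)) : κ * ⟪v i, v i⟫_ℝ = (K + 1) / K := by
    refine Fin.cases ?_ (fun i => ?_) i
    · rw [hv0, hκ]
      linear_combination (K + 1) / K * hEn
    · have hun'' := hun' i
      rw [Submodule.coe_inner] at hun''
      rw [hvs, hκ]
      simp only [inner_add_left, inner_add_right, real_inner_smul_left, real_inner_smul_right,
        hEun, real_inner_comm E, mul_zero, zero_add, add_zero]
      have : (K + 1) / K * ((-1 / (K + 1)) ^ 2 + β ^ 2 * (K ^ 3 / ((K - 1) ^ 2 * (K + 2))))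
          = (K + 1) / K := by
        rw [hβ]
        field_simp
        ring
      rw [← this]
      linear_combination (K + 1) / K * ((-1 / (K + 1)) ^ 2 * hEn + β ^ 2 * hun'')
  have h0s (j : Fin (k + 1)) : m (v 0) (v j.succ) = (-1 / K) • (v 0 + v j.succ) := by
    rw [hv0, hvs]
    simp only [map_add, map_smul, hEE, hEu]
    match_scalars
    · field_simp
      ring
    · field_simp
  refine ⟨v, ⟨fun i hi => ?_, ?_, ?_, ?_⟩, fun i => by rw [hnorm, add_sub_cancel_right]⟩
  · have := hnorm i
    rw [hi, inner_zero_left, mul_zero] at this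
    exact div_ne_zero hK3 hK0 this.symm
  · have hus : ∑ i, (u i : V) = 0 := by
      have := congrArg (Submodule.subtype _) hu.sum_eq_zero
      simpa using this
    rw [Fin.sum_univ_succ, hv0]
    simp only [hvs]
    rw [Finset.sum_add_distrib, ← Finset.smul_sum, ← Finset.smul_sum, hus, Finset.sum_const,
      Finset.card_univ, Fintype.card_fin, smul_zero, add_zero, ← Nat.cast_smul_eq_nsmul ℝ, hcast]
    match_scalars
    field_simp
    ring
  · intro i
    refine Fin.cases ?_ (fun i => ?_) i
    · rw [hv0, hEE]
    · rw [hvs]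
      simp only [map_add, map_smul, LinearMap.add_apply, LinearMap.smul_apply, hEE, hEu, huE, huu,
        hu.mul_self, hun']
      rw [hβ]
      match_scalars <;> field_simp <;> ring
  · intro i j
    rw [hα]
    refine Fin.cases (Fin.cases (fun h => absurd rfl h) (fun j _ => h0s j) j) (fun i => ?_) i
    refine Fin.cases (fun _ => ?_) (fun j hij => ?_) j
    · rw [hm.comm, h0s, add_comm]
    · have hij' : i ≠ j := fun h => hij (congrArg _ h)
      rw [hvs, hvs]
      simp only [map_add, map_smul, LinearMap.add_apply, LinearMap.smul_apply, hEE, hEu, huE, huu,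
        humne i j hij', hune i j hij', Submodule.coe_smul, Submodule.coe_add]
      rw [hβ]
      match_scalars <;> field_simp <;> ring

end IsKillingSpace

end Simplices

/-! ### Classification in dimensions one to four. -/

section LowDimension

variable {V : Type*} [NormedAddCommGroup V] [InnerProductSpace ℝ V]
  {m : V →ₗ[ℝ] V →ₗ[ℝ] V} {κ c : ℝ} {e : V}

theorem mul_eq_smul_of_eig_eq {k : ℕ} {s : ℝ} {a : Fin k → ℝ}
    (b : OrthonormalBasis (Fin k) ℝ (ℝ ∙ e)ᗮ) (hb : ∀ i, m e (b i) = a i • (b i : V))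
    (ha : ∀ i, a i = s) (x : (ℝ ∙ e)ᗮ) : m e x = s • (x : V) := by
  have h : m e ∘ₗ (ℝ ∙ e)ᗮ.subtype = s • (ℝ ∙ e)ᗮ.subtype := by
    refine b.toBasis.ext fun i => ?_
    rw [b.coe_toBasis]
    exact (hb i).trans (by rw [ha]; rfl)
  exact LinearMap.congr_fun h x

variable [FiniteDimensional ℝ V]

theorem IsKillingSpace.exists_adapted {k : ℕ} (hm : IsKillingSpace m κ) (hκ : 0 < κ)
    (hV : Module.finrank ℝ V = k + 1) :
    ∃ (e : V) (c : ℝ) (b : OrthonormalBasis (Fin k) ℝ (ℝ ∙ e)ᗮ) (a : Fin k → ℝ),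
      ‖e‖ = 1 ∧ 0 < c ∧ m e e = c • e ∧ (∀ i, m e (b i) = a i • (b i : V)) ∧ (∀ i, a i ≤ c / 2) ∧
      IsComplementData κ c a fun i j l => ⟪compressMul (ℝ ∙ e)ᗮ m (b i) (b j), b l⟫_ℝ := by
  have : Nontrivial V := Module.nontrivial_of_finrank_pos (R := ℝ) (by omega)
  obtain ⟨e, c, hn, hc, he, hle⟩ := hm.exists_extremal (hm.ne_zero hκ)
  obtain ⟨b, a, hb, hC⟩ := hm.exists_complementData hn he hV
  refine ⟨e, c, b, a, hn, hc, he, hb, fun i => ?_, hC⟩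
  have h1 : ‖(b i : V)‖ = 1 := b.norm_eq_one i
  have h := hle (b i) (inner_orthogonal_unit _) h1
  rwa [hb, real_inner_smul_left, real_inner_self_eq_norm_sq, h1, one_pow, mul_one] at h

/-- The two-dimensional orthogonal summands of the algebra `E^2 ⊕ E^2`. -/
def HasSplitting {V : Type*} [AddCommGroup V] [Module ℝ V] (m : V →ₗ[ℝ] V →ₗ[ℝ] V) : Prop :=
  ∃ v w : Fin (2 + 1) → V, IsSimplex m v ∧ IsSimplex m w ∧ (∀ i j, m (v i) (w j) = 0) ∧
    Disjoint (Submodule.span ℝ (Set.range v)) (Submodule.span ℝ (Set.range w))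

namespace IsKillingSpace

/-- With no complement, the trace of `m e` would be `c > 0`, against exactness. -/
theorem finrank_ne_one (hm : IsKillingSpace m κ) (hκ : 0 < κ) : Module.finrank ℝ V ≠ 1 := by
  intro hV
  obtain ⟨e, c, b, a, hn, hc, he, hb, -, hC⟩ := hm.exists_adapted (k := 0) hκ hV
  have := hC.sum_eig
  simp only [Finset.univ_eq_empty, Finset.sum_empty] at this
  linarith

theorem hasSimplex_two (hm : IsKillingSpace m κ) (hκ : 0 < κ) (hV : Module.finrank ℝ V = 2) :
    HasSimplex 2 m κ := by
  obtain ⟨e, c, b, a, hn, hc, he, hb, -, hC⟩ := hm.exists_adapted (k := 1) hκ hV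
  have ha : a 0 = -c := by simpa using hC.sum_eig
  have hκc : κ = 2 * c ^ 2 := by
    have := hC.sum_eig_sq
    simp only [Fin.sum_univ_one, ha] at this
    linarith
  -- On a line, a trace-free product is zero.
  have hff : compressMul (ℝ ∙ e)ᗮ m (b 0) (b 0) = 0 := by
    have h := hC.trace_mul 0
    rw [Fin.sum_univ_one, real_inner_comm] at h
    rw [← b.sum_repr' (compressMul (ℝ ∙ e)ᗮ m (b 0) (b 0)), Fin.sum_univ_one, h, zero_smul]
  have hbn : ‖(b 0 : V)‖ = 1 := b.norm_eq_one 0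
  obtain ⟨v, hv, hvn, -⟩ := exists_isSimplex_two (f := (b 0 : V)) hm.comm hc.ne' hn hbn
    (inner_orthogonal_unit _) he (by rw [hb, ha]) (by
      rw [hm.mul_eq_compressMul_add hn, hff, hb, ha, real_inner_smul_left,
        real_inner_self_eq_norm_sq, hbn]
      simp)
  refine ⟨v, hv, fun i => ?_⟩
  rw [hκc, mul_assoc, hvn]
  norm_num

theorem hasSimplex_of_eig_eq {k : ℕ} (hk : 2 ≤ k) (hm : IsKillingSpace m κ) (hn : ‖e‖ = 1)
    (hc : 0 < c) (he : m e e = c • e) {a : Fin k → ℝ}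
    (b : OrthonormalBasis (Fin k) ℝ (ℝ ∙ e)ᗮ) (hb : ∀ i, m e (b i) = a i • (b i : V))
    (ha : ∀ i, a i = -(c / k)) (hsq : ∑ i, a i ^ 2 = κ - c ^ 2)
    (ih : ∀ κ', 0 < κ' → IsKillingSpace (compressMul (ℝ ∙ e)ᗮ m) κ' →
      HasSimplex k (compressMul (ℝ ∙ e)ᗮ m) κ') :
    HasSimplex (k + 1) m κ := by
  have hs := mul_eq_smul_of_eig_eq b hb ha
  have hk' : (2 : ℝ) ≤ k := by exact_mod_cast hk
  have hk0 : (k : ℝ) ≠ 0 := by positivity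
  have hκ : κ = c ^ 2 * (k + 1) / k := by
    simp only [ha, Finset.sum_const, Finset.card_univ, Fintype.card_fin, nsmul_eq_mul] at hsq
    field_simp at hsq ⊢
    linear_combination -hsq
  refine hm.hasSimplex_succ hk hn hc.ne' he hs hκ (ih _ ?_ (hm.compressMul_of_scalar hn he hs))
  -- The Killing constant of the compressed product; it is positive because `k ≥ 2`.
  have h : κ - 2 * (-(c / k)) ^ 2 = c ^ 2 * ((k - 1) * (k + 2)) / k ^ 2 := by
    rw [hκ]
    field_simp
    ring
  rw [h]
  have : (0 : ℝ) < k - 1 := by linarith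
  positivity

theorem hasSimplex_three (hm : IsKillingSpace m κ) (hκ : 0 < κ) (hV : Module.finrank ℝ V = 3) :
    HasSimplex 3 m κ := by
  obtain ⟨e, c, b, a, hn, hc, he, hb, -, hC⟩ := hm.exists_adapted (k := 2) hκ hV
  exact hm.hasSimplex_of_eig_eq le_rfl hn hc he b hb (hC.eig_eq_of_two hc.ne') hC.sum_eig_sq
    fun κ' hκ' h => h.hasSimplex_two hκ' (finrank_orthogonal_unit hn hV)

/-- The vectors `e` and `f = b i₀` span a copy of `E^2`, and both annihilate the orthogonal plane.
The product therefore restricts to that plane, with the same Killing constant `κ`, and the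
two-dimensional case applies. -/
theorem hasSplitting_of_eig {k : ℕ} (hV : Module.finrank ℝ V = 3 + 1) (hm : IsKillingSpace m κ)
    (hκ : 0 < κ) (hn : ‖e‖ = 1) (hc : 0 < c) (he : m e e = c • e) {a : Fin k → ℝ}
    (b : OrthonormalBasis (Fin k) ℝ (ℝ ∙ e)ᗮ) (hb : ∀ i, m e (b i) = a i • (b i : V)) (i₀ : Fin k)
    (ha : a i₀ = -c) (ha' : ∀ j, j ≠ i₀ → a j = 0)
    (hC : ∀ j l, ⟪compressMul (ℝ ∙ e)ᗮ m (b i₀) (b j), b l⟫_ℝ = 0) : HasSplitting m := by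
  obtain ⟨f, hf⟩ : ∃ f, f = b i₀ := ⟨_, rfl⟩
  have hfn : ‖f‖ = 1 := hf ▸ b.norm_eq_one i₀
  have hfn' : ‖(f : V)‖ = 1 := hfn
  have hef : m e f = -c • (f : V) := by rw [hf, hb, ha]
  have hm' := hm.toIsMetrized.compressMul (ℝ ∙ e)ᗮ
  have hf0 : compressMul (ℝ ∙ e)ᗮ m f = 0 := by
    refine b.toBasis.ext fun j => ?_
    rw [b.coe_toBasis, ← b.sum_repr' (compressMul (ℝ ∙ e)ᗮ m f (b j)), hf]
    exact Finset.sum_eq_zero fun l _ => by rw [real_inner_comm, hC, zero_smul]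
  -- Written as an eigenvector equation with eigenvalue `0`, so that the compression lemmas apply to
  -- `f` inside the complement of `e`.
  have hff0 : compressMul (ℝ ∙ e)ᗮ m f f = (0 : ℝ) • f := by
    rw [hf0, zero_smul, LinearMap.zero_apply]
  have he0 (x : (ℝ ∙ e)ᗮ) (hx : ⟪f, x⟫_ℝ = 0) : m e x = 0 := by
    rw [← b.sum_repr' x, Submodule.coe_sum, map_sum]
    refine Finset.sum_eq_zero fun j _ => ?_
    rw [Submodule.coe_smul, map_smul, hb]
    by_cases hj : j = i₀
    · rw [hj, ← hf, hx, zero_smul]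
    · rw [ha' j hj, zero_smul, smul_zero]
  have hmf (x : (ℝ ∙ e)ᗮ) : m f x = (-c * ⟪f, x⟫_ℝ) • e := by
    rw [hm.mul_eq_compressMul_add hn, hf0, hef, real_inner_smul_left, Submodule.coe_inner]
    simp
  have hff : m f f = -c • e := by
    rw [hmf, real_inner_self_eq_norm_sq, hfn]
    simp
  have hKS : IsKillingSpace (compressMul (ℝ ∙ f)ᗮ (compressMul (ℝ ∙ e)ᗮ m)) κ :=
    { toIsMetrized := hm'.compressMul _
      exact := fun x => by
        rw [hm'.trace_compressMul hfn hff0, hm.trace_compressMul hn he, hm.exact]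
      killing := fun x y => by
        rw [hm'.trace_compressMul_comp hfn hff0, hm.trace_compressMul_comp hn he, hm.killing,
          hf0, he0 x (inner_orthogonal_unit x)]
        simp }
  obtain ⟨u, hu, -⟩ := hKS.hasSimplex_two hκ
    (finrank_orthogonal_unit hfn (finrank_orthogonal_unit hn hV))
  obtain ⟨v, hv, -, hvs⟩ := exists_isSimplex_two hm.comm hc.ne' hn hfn' (inner_orthogonal_unit f)
    he hef hff
  let w : Fin (2 + 1) → V := fun i => ((u i : (ℝ ∙ e)ᗮ) : V)
  have heu (i : Fin (2 + 1)) : m e (w i) = 0 := he0 _ (inner_orthogonal_unit (u i))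
  have hfu (i : Fin (2 + 1)) : m f (w i) = 0 := by
    rw [hmf, inner_orthogonal_unit, mul_zero, zero_smul]
  have hww (i j : Fin (2 + 1)) : m (w i) (w j)
      = ((compressMul (ℝ ∙ f)ᗮ (compressMul (ℝ ∙ e)ᗮ m) (u i) (u j) : (ℝ ∙ e)ᗮ) : V) := by
    rw [hm.mul_eq_compressMul_add hn, heu, inner_zero_left, zero_smul, add_zero,
      hm'.mul_eq_compressMul_add hfn, hf0, LinearMap.zero_apply, inner_zero_left, zero_smul,
      add_zero]
  refine ⟨v, w, hv, ⟨fun i hi => ?_, ?_, fun i => ?_, fun i j hij => ?_⟩, fun i j => ?_, ?_⟩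
  · exact hu.ne_zero i (Subtype.ext (Subtype.ext hi))
  · have h := congrArg (fun x : (ℝ ∙ f)ᗮ => ((x : (ℝ ∙ e)ᗮ) : V)) hu.sum_eq_zero
    simpa using h
  · rw [hww, hu.mul_self]
  · rw [hww, hu.mul_of_ne i j hij]
    rfl
  · obtain ⟨p, q, hpq⟩ := Submodule.mem_span_pair.1 (hvs i)
    rw [← hpq, map_add, map_smul, map_smul, LinearMap.add_apply, LinearMap.smul_apply,
      LinearMap.smul_apply, heu, hfu, smul_zero, smul_zero, add_zero]
  · refine Submodule.IsOrtho.disjoint (Submodule.isOrtho_span.2 ?_)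
    rintro _ ⟨i, rfl⟩ _ ⟨j, rfl⟩
    obtain ⟨p, q, hpq⟩ := Submodule.mem_span_pair.1 (hvs i)
    have h1 : ⟪e, w j⟫_ℝ = 0 := inner_orthogonal_unit _
    have h2 : ⟪(f : V), w j⟫_ℝ = 0 := inner_orthogonal_unit (u j)
    rw [← hpq, inner_add_left, real_inner_smul_left, real_inner_smul_left, h1, h2, mul_zero,
      mul_zero, add_zero]

theorem hasSimplex_four_or_hasSplitting (hm : IsKillingSpace m κ) (hκ : 0 < κ)
    (hV : Module.finrank ℝ V = 4) : HasSimplex 4 m κ ∨ HasSplitting m := by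
  obtain ⟨e, c, b, a, hn, hc, he, hb, hle, hC⟩ := hm.exists_adapted (k := 3) hκ hV
  rcases hC.eig_eq_or_exists hc hle with ha | ⟨i, ha, ha', hCi⟩
  · left
    exact hm.hasSimplex_of_eig_eq (by norm_num) hn hc he b hb ha hC.sum_eig_sq
      fun κ' hκ' h => h.hasSimplex_three hκ' (finrank_orthogonal_unit hn hV)
  · exact Or.inr (hm.hasSplitting_of_eig hV hκ hn hc he b hb i ha ha' hCi)

end IsKillingSpace

end LowDimension

/-! ### Generalities on algebra isomorphisms. -/

section Isomorphism

variable {A B : Type*} [NonUnitalNonAssocRing A] [Module ℝ A] [NonUnitalNonAssocRing B]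
  [Module ℝ B]

theorem algIsomorphic_of_injective
    [FiniteDimensional ℝ A] [FiniteDimensional ℝ B] (φ : B →ₗ[ℝ] A)
    (hφ : ∀ x y, φ (x * y) = φ x * φ y) (hinj : Function.Injective φ)
    (hdim : Module.finrank ℝ B = Module.finrank ℝ A) : AlgIsomorphic ℝ A B := by
  let e := LinearMap.linearEquivOfInjective φ hinj hdim
  refine ⟨e.symm, fun x y => e.injective ?_⟩
  have he (z : B) : e z = φ z := rfl
  rw [he (_ * _), hφ, ← he, ← he, e.apply_symm_apply, e.apply_symm_apply, e.apply_symm_apply]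

theorem AlgIsomorphic.finrank_eq
    (h : AlgIsomorphic ℝ A B) : Module.finrank ℝ A = Module.finrank ℝ B :=
  h.choose.finrank_eq

theorem AlgIsomorphic.symm_trans {C : Type*} [NonUnitalNonAssocRing C]
    [Module ℝ C] (h : AlgIsomorphic ℝ A B)
    (h' : AlgIsomorphic ℝ A C) : AlgIsomorphic ℝ B C := by
  obtain ⟨e, he⟩ := h
  obtain ⟨e', he'⟩ := h'
  refine ⟨e.symm.trans e', fun x y => ?_⟩
  have h1 : e.symm (x * y) = e.symm x * e.symm y :=
    e.injective (by rw [he, e.apply_symm_apply, e.apply_symm_apply, e.apply_symm_apply])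
  rw [LinearEquiv.trans_apply, h1, he']
  rfl

end Isomorphism

/-! ### Recognizing and distinguishing the simplicial algebras. -/

section Simplicial

instance finiteDimensional_TAlg (n : ℕ) (α : ℝ) : FiniteDimensional ℝ (TAlg ℝ n α) :=
  inferInstanceAs (FiniteDimensional ℝ (Fin n → ℝ))

instance finiteDimensional_EAlg (n : ℕ) : FiniteDimensional ℝ (EAlg ℝ n) :=
  inferInstanceAs (FiniteDimensional ℝ (TAlg ℝ (n + 1) (-1 / ((n : ℝ) - 1)) ⧸
    maxAlgIdeal ℝ (TAlg ℝ (n + 1) (-1 / ((n : ℝ) - 1)))))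

theorem finrank_EAlg {n : ℕ} (hn : 2 ≤ n) : Module.finrank ℝ (EAlg ℝ n) = n := by
  have h := Submodule.finrank_quotient_add_finrank
    (maxAlgIdeal ℝ (TAlg ℝ (n + 1) (-1 / ((n : ℝ) - 1))))
  have hT : Module.finrank ℝ (TAlg ℝ (n + 1) (-1 / ((n : ℝ) - 1))) = n + 1 := by
    rw [(TAlg.coeff (F := ℝ)).finrank_eq, Module.finrank_fin_fun]
  have h0 : (∑ i, TAlg.e i : TAlg ℝ (n + 1) (-1 / ((n : ℝ) - 1))) ≠ 0 := by
    intro h0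
    have := congrFun (congrArg TAlg.coeff h0) 0
    simp [map_sum, TAlg.coeff_e] at this
  have h1 : Module.finrank ℝ (maxAlgIdeal ℝ (TAlg ℝ (n + 1) (-1 / ((n : ℝ) - 1)))) = 1 := by
    rw [maxAlgIdeal_TAlg ℝ hn, finrank_span_singleton h0]
  rw [h1, hT] at h
  exact Nat.add_right_cancel h

theorem EAlg.mk_surjective (n : ℕ) : Function.Surjective (EAlg.mk ℝ n) :=
  Submodule.mkQ_surjective _

theorem EAlg.mk_eq_zero {n : ℕ} {x : TAlg ℝ (n + 1) (-1 / ((n : ℝ) - 1))} :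
    EAlg.mk ℝ n x = 0 ↔ x ∈ maxAlgIdeal ℝ (TAlg ℝ (n + 1) (-1 / ((n : ℝ) - 1))) :=
  Submodule.Quotient.mk_eq_zero _

variable {A : Type*} [NonUnitalNonAssocCommRing A] [Module ℝ A]
  [IsScalarTower ℝ A A] [SMulCommClass ℝ A A]

/-- A simplex of idempotents spans a copy of the simplicial algebra. -/
theorem IsSimplex.exists_embedding {n : ℕ} (hn : 2 ≤ n) {v : Fin (n + 1) → A}
    (hv : IsSimplex (LinearMap.mul ℝ A) v) :
    ∃ φ : EAlg ℝ n →ₗ[ℝ] A, (∀ x y, φ (x * y) = φ x * φ y) ∧ Function.Injective φ ∧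
      ∀ x, φ x ∈ Submodule.span ℝ (Set.range v) := by
  let ψ : TAlg ℝ (n + 1) (-1 / ((n : ℝ) - 1)) →ₗ[ℝ] A :=
    Fintype.linearCombination ℝ v ∘ₗ TAlg.coeff.toLinearMap
  have hψ (x : TAlg ℝ (n + 1) (-1 / ((n : ℝ) - 1))) : ψ x = ∑ i, TAlg.coeff x i • v i := rfl
  have hψe (i : Fin (n + 1)) : ψ (TAlg.e i) = v i := by
    rw [hψ]
    simp [TAlg.coeff_e]
  have hψee (i j : Fin (n + 1)) : ψ (TAlg.e i * TAlg.e j) = v i * v j := by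
    by_cases hij : i = j
    · subst hij
      rw [TAlg.e_mul_e_self, hψe]
      exact (hv.mul_self i).symm
    · rw [TAlg.e_mul_e_of_ne hij, map_smul, map_add, hψe, hψe]
      exact (hv.mul_of_ne i j hij).symm
  have hmul (x y : TAlg ℝ (n + 1) (-1 / ((n : ℝ) - 1))) : ψ (x * y) = ψ x * ψ y := by
    rw [TAlg.eq_sum_e x, TAlg.eq_sum_e y]
    simp only [Finset.sum_mul, Finset.mul_sum, map_sum, smul_mul_assoc, mul_smul_comm, map_smul,
      hψee, hψe]
  -- The kernel of a nonzero homomorphism is a proper ideal, so maximality gives injectivity on the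
  -- quotient.
  have hker : LinearMap.ker ψ ≤ maxAlgIdeal ℝ (TAlg ℝ (n + 1) (-1 / ((n : ℝ) - 1))) := by
    refine le_sSup ⟨fun a x hx => ?_, fun h => hv.ne_zero 0 ?_⟩
    · rw [LinearMap.mem_ker] at hx ⊢
      rw [hmul, hx, mul_zero]
    · rw [← hψe, ← LinearMap.mem_ker, h]
      trivial
  have hle : maxAlgIdeal ℝ (TAlg ℝ (n + 1) (-1 / ((n : ℝ) - 1))) ≤ LinearMap.ker ψ := by
    rw [maxAlgIdeal_TAlg ℝ hn, Submodule.span_singleton_le_iff_mem, LinearMap.mem_ker, map_sum]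
    simp only [hψe, hv.sum_eq_zero]
  let φ : EAlg ℝ n →ₗ[ℝ] A := Submodule.liftQ _ ψ hle
  have hφ (x : TAlg ℝ (n + 1) (-1 / ((n : ℝ) - 1))) : φ (EAlg.mk ℝ n x) = ψ x := rfl
  refine ⟨φ, fun x y => ?_, ?_, fun x => ?_⟩
  · obtain ⟨x, rfl⟩ := EAlg.mk_surjective n x
    obtain ⟨y, rfl⟩ := EAlg.mk_surjective n y
    rw [← EAlg.mk_mul, hφ, hφ, hφ, hmul]
  · refine (injective_iff_map_eq_zero φ).2 fun x hx => ?_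
    obtain ⟨x, rfl⟩ := EAlg.mk_surjective n x
    exact EAlg.mk_eq_zero.2 (hker (LinearMap.mem_ker.2 hx))
  · obtain ⟨x, rfl⟩ := EAlg.mk_surjective n x
    rw [hφ, hψ]
    exact Submodule.sum_mem _ fun i _ =>
      Submodule.smul_mem _ _ (Submodule.subset_span ⟨i, rfl⟩)

theorem IsSimplex.algIsomorphic [FiniteDimensional ℝ A] {n : ℕ} (hn : 2 ≤ n) {v : Fin (n + 1) → A}
    (hv : IsSimplex (LinearMap.mul ℝ A) v) (hA : Module.finrank ℝ A = n) :
    AlgIsomorphic ℝ A (EAlg ℝ n) := by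
  obtain ⟨φ, hφ, hinj, -⟩ := hv.exists_embedding hn
  exact algIsomorphic_of_injective φ hφ hinj (by rw [finrank_EAlg hn, hA])

theorem finrank_EAlg_prod : Module.finrank ℝ (EAlg ℝ 2 × EAlg ℝ 2) = 4 := by
  rw [Module.finrank_prod, finrank_EAlg le_rfl]

theorem HasSplitting.algIsomorphic [FiniteDimensional ℝ A] (h : HasSplitting (LinearMap.mul ℝ A))
    (hA : Module.finrank ℝ A = 4) : AlgIsomorphic ℝ A (EAlg ℝ 2 × EAlg ℝ 2) := by
  obtain ⟨v, w, hv, hw, hvw, hdisj⟩ := h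
  obtain ⟨φ, hφ, hφi, hφv⟩ := hv.exists_embedding le_rfl
  obtain ⟨ψ, hψ, hψi, hψw⟩ := hw.exists_embedding le_rfl
  have hzero (x y : EAlg ℝ 2) : φ x * ψ y = 0 := by
    have h1 (i : Fin (2 + 1)) : ψ y ∈ LinearMap.ker (LinearMap.mul ℝ A (v i)) := by
      refine Submodule.span_le.2 ?_ (hψw y)
      rintro _ ⟨j, rfl⟩
      exact hvw i j
    have h2 : φ x ∈ LinearMap.ker (LinearMap.mul ℝ A (ψ y)) := by
      refine Submodule.span_le.2 ?_ (hφv x)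
      rintro _ ⟨i, rfl⟩
      have := h1 i
      rw [LinearMap.mem_ker, LinearMap.mul_apply', mul_comm] at this
      exact this
    rw [LinearMap.mem_ker, LinearMap.mul_apply', mul_comm] at h2
    exact h2
  refine algIsomorphic_of_injective (LinearMap.coprod φ ψ) (fun x y => ?_) ?_
    (by rw [finrank_EAlg_prod, hA])
  · simp only [LinearMap.coprod_apply, Prod.fst_mul, Prod.snd_mul, hφ, hψ, mul_add, add_mul, hzero]
    rw [mul_comm (ψ _) (φ _), hzero, add_zero, zero_add]
  · refine (injective_iff_map_eq_zero _).2 fun x hx => ?_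
    rw [LinearMap.coprod_apply, add_eq_zero_iff_eq_neg] at hx
    have h0 : φ x.1 = 0 := Submodule.disjoint_def.1 hdisj _ (hφv _)
      (hx ▸ Submodule.neg_mem _ (hψw _))
    have h1 : ψ x.2 = 0 := by rw [h0] at hx; exact neg_eq_zero.1 hx.symm
    exact Prod.ext ((map_eq_zero_iff φ hφi).1 h0) ((map_eq_zero_iff ψ hψi).1 h1)

theorem nontrivial_EAlg {n : ℕ} (hn : 2 ≤ n) : Nontrivial (EAlg ℝ n) :=
  Module.nontrivial_of_finrank_pos (R := ℝ) (by rw [finrank_EAlg hn]; omega)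

/-- A simplicial algebra is not a direct sum of two nonzero algebras. -/
theorem not_algIsomorphic_EAlg_prod {n : ℕ} {B C : Type*} [NonUnitalNonAssocRing B]
    [Module ℝ B] [NonUnitalNonAssocRing C] [Module ℝ C] [Nontrivial B] [Nontrivial C] :
    ¬ AlgIsomorphic ℝ (EAlg ℝ n) (B × C) := by
  rintro ⟨e, he⟩
  -- The preimage of the ideal `B × 0`: being proper, it lies in the maximal ideal, so `B × 0` would
  -- be zero.
  let J : Submodule ℝ (TAlg ℝ (n + 1) (-1 / ((n : ℝ) - 1))) :=
    LinearMap.ker (LinearMap.snd ℝ B C ∘ₗ e.toLinearMap ∘ₗ EAlg.mk ℝ n)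
  have hJ (x : TAlg ℝ (n + 1) (-1 / ((n : ℝ) - 1))) : x ∈ J ↔ (e (EAlg.mk ℝ n x)).2 = 0 := Iff.rfl
  have hlift (z : B × C) : ∃ x, e (EAlg.mk ℝ n x) = z := by
    obtain ⟨x, hx⟩ := EAlg.mk_surjective n (e.symm z)
    exact ⟨x, by rw [hx, e.apply_symm_apply]⟩
  have hle : J ≤ maxAlgIdeal ℝ _ := by
    refine le_sSup ⟨fun a x hx => ?_, fun h => ?_⟩
    · rw [hJ] at hx ⊢
      rw [EAlg.mk_mul, he, Prod.snd_mul, hx, mul_zero]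
    · obtain ⟨y, hy⟩ := exists_ne (0 : C)
      obtain ⟨x, hx⟩ := hlift (0, y)
      have hxJ : x ∈ J := h ▸ Submodule.mem_top
      rw [hJ, hx] at hxJ
      exact hy hxJ
  obtain ⟨y, hy⟩ := exists_ne (0 : B)
  obtain ⟨x, hx⟩ := hlift (y, 0)
  have hxJ : x ∈ J := by rw [hJ, hx]
  have h0 := EAlg.mk_eq_zero.2 (hle hxJ)
  rw [h0, map_zero] at hx
  exact hy (congrArg Prod.fst hx).symm

variable (A) in
-- The Killing form itself serves as inner product, so the Killing constant is `1`.
theorem exists_isSimplex_or_hasSplitting [FiniteDimensional ℝ A] [Nontrivial A]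
    (hdim : Module.finrank ℝ A ≤ 4) (hexact : IsExactAlg ℝ A)
    (hkilling : IsEuclideanKillingMetrized A) :
    (∃ n, 2 ≤ n ∧ n ≤ 4 ∧ Module.finrank ℝ A = n ∧
        ∃ v : Fin (n + 1) → A, IsSimplex (LinearMap.mul ℝ A) v) ∨
      (Module.finrank ℝ A = 4 ∧ HasSplitting (LinearMap.mul ℝ A)) := by
  let core : InnerProductSpace.Core ℝ A :=
    { inner := fun x y => algKillingForm ℝ A x y
      conj_inner_symm := fun x y => by
        simp only [algKillingForm_apply, conj_trivial]
        exact LinearMap.trace_comp_comm' _ _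
      re_inner_nonneg := fun x => by
        by_cases hx : x = 0
        · simp [hx]
        · exact (hkilling.posDef x hx).le
      add_left := fun x y z => by simp
      smul_left := fun x y r => by simp
      definite := fun x hx => by
        by_contra h
        exact (hkilling.posDef x h).ne' hx }
  let _ : NormedAddCommGroup A := core.toNormedAddCommGroup
  let _ : InnerProductSpace ℝ A := InnerProductSpace.ofCore core.toCore
  have hm : IsKillingSpace (LinearMap.mul ℝ A) 1 :=
    { comm := fun x y => mul_comm x y
      invariant := hkilling.invariant
      exact := hexact
      killing := fun x y => (one_mul _).symm }
  have hpos : 0 < Module.finrank ℝ A := Module.finrank_pos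
  have h1 := hm.finrank_ne_one one_pos
  obtain h | h | h : Module.finrank ℝ A = 2 ∨ Module.finrank ℝ A = 3 ∨ Module.finrank ℝ A = 4 := by
    omega
  · obtain ⟨v, hv, -⟩ := hm.hasSimplex_two one_pos h
    exact Or.inl ⟨2, by norm_num, by norm_num, h, v, hv⟩
  · obtain ⟨v, hv, -⟩ := hm.hasSimplex_three one_pos h
    exact Or.inl ⟨3, by norm_num, by norm_num, h, v, hv⟩
  · rcases hm.hasSimplex_four_or_hasSplitting one_pos h with ⟨v, hv, -⟩ | hs
    · exact Or.inl ⟨4, by norm_num, by norm_num, h, v, hv⟩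
    · exact Or.inr ⟨h, hs⟩

end Simplicial

theorem mainTheorem2 (A : Type*) [NonUnitalNonAssocCommRing A] [Module ℝ A]
    [IsScalarTower ℝ A A] [SMulCommClass ℝ A A] [FiniteDimensional ℝ A] [Nontrivial A]
    (hdim : Module.finrank ℝ A ≤ 4)
    (hexact : IsExactAlg ℝ A) (hkilling : IsEuclideanKillingMetrized A) :
    ∃! i : Fin 4,
      ![AlgIsomorphic ℝ A (EAlg ℝ 2),
        AlgIsomorphic ℝ A (EAlg ℝ 3),
        AlgIsomorphic ℝ A (EAlg ℝ 4),
        AlgIsomorphic ℝ A (EAlg ℝ 2 × EAlg ℝ 2)] i := by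
  have hE {n : ℕ} (hn : 2 ≤ n) (h : AlgIsomorphic ℝ A (EAlg ℝ n)) : Module.finrank ℝ A = n := by
    rw [h.finrank_eq, finrank_EAlg hn]
  have hP (h : AlgIsomorphic ℝ A (EAlg ℝ 2 × EAlg ℝ 2)) : Module.finrank ℝ A = 4 := by
    rw [h.finrank_eq, finrank_EAlg_prod]
  have h2 := hE (n := 2) (by norm_num)
  have h3 := hE (n := 3) (by norm_num)
  have h4 := hE (n := 4) (by norm_num)
  have h5 (h : AlgIsomorphic ℝ A (EAlg ℝ 4)) : ¬ AlgIsomorphic ℝ A (EAlg ℝ 2 × EAlg ℝ 2) := by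
    have := nontrivial_EAlg (n := 2) le_rfl
    exact fun h' => not_algIsomorphic_EAlg_prod (h.symm_trans h')
  rcases exists_isSimplex_or_hasSplitting A hdim hexact hkilling with
    ⟨n, hn2, hn4, hA, v, hv⟩ | ⟨hA, hs⟩
  · have h := hv.algIsomorphic hn2 hA
    obtain rfl | rfl | rfl : n = 2 ∨ n = 3 ∨ n = 4 := by omega
    · refine ⟨0, h, fun j hj => ?_⟩
      fin_cases j
      · rfl
      · exact absurd (h3 hj) (by omega)
      · exact absurd (h4 hj) (by omega)
      · exact absurd (hP hj) (by omega)
    · refine ⟨1, h, fun j hj => ?_⟩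
      fin_cases j
      · exact absurd (h2 hj) (by omega)
      · rfl
      · exact absurd (h4 hj) (by omega)
      · exact absurd (hP hj) (by omega)
    · refine ⟨2, h, fun j hj => ?_⟩
      fin_cases j
      · exact absurd (h2 hj) (by omega)
      · exact absurd (h3 hj) (by omega)
      · rfl
      · exact absurd hj (h5 h)
  · have h := hs.algIsomorphic hA
    refine ⟨3, h, fun j hj => ?_⟩
    fin_cases j
    · exact absurd (h2 hj) (by omega)
    · exact absurd (h3 hj) (by omega)
    · exact absurd h (h5 hj)
    · rfl
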